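/- **Conventions.** Manifolds are Hausdorff and modelled on (Hausdorff, real) locally convex spaces, smooth means $C^\infty$ in the sense of Michal–Bastiani, and a Lie group is a group that is a manifold with smooth operations. A (unital) 2-group is a small category $\mathcal G$ (objects $\mathcal G_0$, morphisms $\mathcal G_1$) with a multiplication functor $\otimes$, an inversion functor $g\mapsto\overline g$ and a unit object $\mathbb 1$ such that $g\otimes\mathbb 1=g=\mathbb 1\otimes g$ and $g\otimes\overline g=\mathbb 1=\overline g\otimes g$ on objects and morphisms, and with natural isomorphisms (associators) $\alpha_{g,h,k}\colon(g\otimes h)\otimes k\to g\otimes(h\otimes k)$ that satisfy the pentagon identity and are identities if one of $g,h,k$ is $\mathbb 1$ and for $(g,\overline g,g)$ and $(\overline g,g,\overline g)$. A morphism of 2-groups is a functor $\mathcal F$ with $\mathcal F(\mathbb 1)=\mathbb 1$ and coherent natural isomorphisms $\mathcal F(g)\otimes\mathcal F(h)\to\mathcal F(g\otimes h)$ that are identities if $g=\mathbb 1$, $h=\mathbb 1$, $h=\overline g$ or $g=\overline h$. A Lie 2-group is a 2-group whose sets of objects, morphisms, and composable pairs and triples (as fibre products) are manifolds, with smooth structure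 maps, such that the group functors and the associator are smooth on some open subcategory containing $\mathbb 1$; a morphism of Lie 2-groups is a morphism of 2-groups that is smooth on some open subcategory containing $\mathbb 1$. The group $\operatorname{skel}(\mathcal G)$ is the set of isomorphism classes of objects of $\mathcal G$ with the multiplication induced by $\otimes$. Let $A$ and $Z$ be abelian Lie groups, $A$ discrete, and $\tau\colon A\to Z$ a homomorphism. The strict abelian Lie 2-group $\mathcal Z=\mathcal Z_{(\tau\colon A\to Z)}$ has objects $Z$ and morphisms $A\times Z$, where $(a,z)$ goes from $z$ to $\tau(a)+z$, with componentwise multiplication. For a Lie group $G$ let $\underline G$ be the 2-group with objects $G$ and only identity morphisms. A smooth generalised central extension (s.g.c.e.) of $G$ by $\mathcal Z$ is a sequence of morphisms of Lie 2-groups $$\mathcal Z\xrightarrow{\ \iota\ }\widehat{\mathcal G}\xrightarrow{\ q\ }\underline G$$ such that $\iota(a)\otimes g=g\otimes\iota(a)$ for all morphisms $a$ of $\mathcal Z$ and $g$ of $\widehat{\mathcal G}$; $\iota$ is injective on morphisms; a morphism $g$ of $\widehat{\mathcal G}$ lies in the image of $\iota$ if and only if $q(g)=\mathbb 1$; $q$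 is surjective on morphisms; the inverse of the bijection $\iota\colon Z\to\iota(Z)\subseteq\widehat{\mathcal G}_0$ is smooth near $\mathbb 1$ (that is, near $\mathbb 1$ it is the restriction of a smooth map from an open neighbourhood of $\mathbb 1$ in $\widehat{\mathcal G}_0$ to $Z$); and there are an open unit neighbourhood $U\subseteq G$ and a smooth functor $s\colon\underline U\to\widehat{\mathcal G}$ with $s(1)=\mathbb 1$ and $q\circ s=\mathrm{id}_{\underline U}$. A subgroup $H$ of a Lie group $K$ is a split Lie subgroup if $H$ carries a Lie group structure and $K/H$ a manifold structure such that $H\hookrightarrow K$ is smooth and $K\to K/H$ is a smooth (locally trivial) principal $H$-bundle. A central extension of Lie groups is a sequence of smooth homomorphisms of Lie groups $N\xrightarrow{i}P\xrightarrow{p}B$ with $i$ injective, $i(N)=\ker p$ central in $P$, and $p$ surjective, such that $p$ is a smooth (locally trivial) principal $N$-bundle. **Proposition.** Let $\mathcal Z\xrightarrow{\iota}\widehat{\mathcal G}\xrightarrow{q}\underline G$ be a smooth generalised central extension of a connected Lie group $G$ by $\mathcal Z=\mathcal Z_{(\tau\colon A\to Z)}$, and assume that $\tau(A)\subseteq Z$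 is a split Lie subgroup. Then: 1. Each of the groups $\operatorname{skel}(\mathcal Z)$ and $\operatorname{skel}(\widehat{\mathcal G})$ carries a Lie group structure, unique up to the identity being a diffeomorphism, for which the projection from the manifold of objects ($Z$, respectively $\widehat{\mathcal G}_0$) to isomorphism classes is smooth near the unit object and has, on some unit neighbourhood, a smooth section that maps the unit to the unit object. 2. The map $[z]\mapsto z+\tau(A)$ is a well-defined isomorphism of Lie groups $\operatorname{skel}(\mathcal Z)\cong Z/\tau(A)$. 3. With these structures, the induced sequence $$\operatorname{skel}(\mathcal Z)\xrightarrow{\operatorname{skel}(\iota)}\operatorname{skel}(\widehat{\mathcal G})\xrightarrow{\operatorname{skel}(q)}\operatorname{skel}(\underline G)=G$$ is a central extension of Lie groups (called the band of the s.g.c.e.). -/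

import Mathlib

open Set Filter Topology

universe u

/-! ## Differential calculus on locally convex spaces -/

/-- `f` is of class `C^n` on the open set `U` in the sense of Michal and Bastiani: `C^0` means
continuous; `C^(n+1)` means that `f` is continuous, that all directional derivatives
`df x v = lim_{h → 0} (f (x + h v) - f x) / h` exist at the points of `U`, and that
`df : U × E → F` is of class `C^n`. Values of `f` outside `U` are irrelevant for open `U`. -/
def BContDiffOn {F : Type u} [AddCommGroup F] [Module ℝ F] [TopologicalSpace F] :
    ℕ → ∀ {E : Type u} [AddCommGroup E] [Module ℝ E] [TopologicalSpace E],
      (E → F) → Set E → Prop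
  | 0, _, _, _, _, f, U => ContinuousOn f U
  | n + 1, E, _, _, _, f, U => ContinuousOn f U ∧ ∃ df : E × E → F,
      (∀ x ∈ U, ∀ v : E, Tendsto (fun h : ℝ => h⁻¹ • (f (x + h • v) - f x)) (𝓝[≠] 0)
        (𝓝 (df (x, v)))) ∧
      BContDiffOn n df (U ×ˢ (univ : Set E))

/-- `f` is smooth on the open set `U`. -/
def BSmoothOn {E F : Type u} [AddCommGroup E] [Module ℝ E] [TopologicalSpace E]
    [AddCommGroup F] [Module ℝ F] [TopologicalSpace F] (f : E → F) (U : Set E) : Prop :=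
  ∀ n : ℕ, BContDiffOn n f U

theorem BContDiffOn.prod_comp {F F' : Type u} [AddCommGroup F] [Module ℝ F] [TopologicalSpace F]
    [AddCommGroup F'] [Module ℝ F'] [TopologicalSpace F'] (n : ℕ) :
    ∀ {E E' X : Type u} [AddCommGroup E] [Module ℝ E] [TopologicalSpace E]
      [AddCommGroup E'] [Module ℝ E'] [TopologicalSpace E']
      [AddCommGroup X] [Module ℝ X] [TopologicalSpace X]
      (L : X →L[ℝ] E) (L' : X →L[ℝ] E') {f : E → F} {f' : E' → F'} {U : Set E} {U' : Set E'},
      BContDiffOn n f U → BContDiffOn n f' U' →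
        BContDiffOn n (fun x => (f (L x), f' (L' x))) (L ⁻¹' U ∩ L' ⁻¹' U') := by
  induction n with
  | zero =>
    intro E E' X _ _ _ _ _ _ _ _ _ L L' f f' U U' hf hf'
    exact (ContinuousOn.comp hf L.continuous.continuousOn fun x hx => hx.1).prodMk
      (ContinuousOn.comp hf' L'.continuous.continuousOn fun x hx => hx.2)
  | succ n ih =>
    intro E E' X _ _ _ _ _ _ _ _ _ L L' f f' U U' hf hf'
    obtain ⟨hc, df, hd, hn⟩ := hf
    obtain ⟨hc', df', hd', hn'⟩ := hf'
    refine ⟨(ContinuousOn.comp hc L.continuous.continuousOn fun x hx => hx.1).prodMk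
      (ContinuousOn.comp hc' L'.continuous.continuousOn fun x hx => hx.2),
      fun p => (df (L.prodMap L p), df' (L'.prodMap L' p)), ?_, ?_⟩
    · intro x hx v
      have h1 := (hd (L x) hx.1 (L v)).prodMk_nhds (hd' (L' x) hx.2 (L' v))
      simpa using h1
    · have h2 := ih (L.prodMap L) (L'.prodMap L') hn hn'
      have h3 : (L.prodMap L) ⁻¹' (U ×ˢ (univ : Set E)) ∩
          (L'.prodMap L') ⁻¹' (U' ×ˢ (univ : Set E')) =
          (L ⁻¹' U ∩ L' ⁻¹' U') ×ˢ (univ : Set X) := by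
        ext p; simp
      rw [h3] at h2
      exact h2

theorem BSmoothOn.prodMap {E E' F F' : Type u} [AddCommGroup E] [Module ℝ E] [TopologicalSpace E]
    [AddCommGroup E'] [Module ℝ E'] [TopologicalSpace E']
    [AddCommGroup F] [Module ℝ F] [TopologicalSpace F]
    [AddCommGroup F'] [Module ℝ F'] [TopologicalSpace F']
    {f : E → F} {f' : E' → F'} {U : Set E} {U' : Set E'}
    (hf : BSmoothOn f U) (hf' : BSmoothOn f' U') :
    BSmoothOn (Prod.map f f') (U ×ˢ U') := fun n =>
  BContDiffOn.prod_comp n (ContinuousLinearMap.fst ℝ E E') (ContinuousLinearMap.snd ℝ E E')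
    (hf n) (hf' n)

/-! ## Manifolds and Lie groups modelled on locally convex spaces -/

/-- A smooth manifold structure on the set `M`: a Hausdorff topology and an atlas with values in a
(Hausdorff, real) locally convex space, with smooth changes of charts. -/
structure LCManifold (M : Type u) where
  [top : TopologicalSpace M]
  [t2 : T2Space M]
  Model : Type u
  [addCommGroup : AddCommGroup Model]
  [module : Module ℝ Model]
  [modelTop : TopologicalSpace Model]
  [topAddGroup : IsTopologicalAddGroup Model]
  [continuousSMul : ContinuousSMul ℝ Model]
  [locallyConvex : LocallyConvexSpace ℝ Model]
  [modelT2 : T2Space Model]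
  charts : Set (OpenPartialHomeomorph M Model)
  exists_chart : ∀ x : M, ∃ e ∈ charts, x ∈ e.source
  compatible : ∀ e ∈ charts, ∀ e' ∈ charts,
    BSmoothOn (fun y => e' (e.symm y)) (e.target ∩ e.symm ⁻¹' e'.source)

attribute [instance] LCManifold.addCommGroup LCManifold.module LCManifold.modelTop
  LCManifold.topAddGroup LCManifold.continuousSMul LCManifold.locallyConvex LCManifold.modelT2

namespace LCManifold

variable {M N : Type u}

/-- Openness with respect to the topology of a manifold structure. -/
def Open (S : LCManifold M) (U : Set M) : Prop := IsOpen[S.top] U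

/-- `f : M → N` is smooth on the open set `U`. -/
def SmoothOn (S : LCManifold M) (T : LCManifold N) (f : M → N) (U : Set M) : Prop :=
  letI := S.top
  letI := T.top
  ContinuousOn f U ∧ ∀ e ∈ S.charts, ∀ e' ∈ T.charts,
    BSmoothOn (fun y => e' (f (e.symm y))) (e.target ∩ e.symm ⁻¹' (U ∩ f ⁻¹' e'.source))

/-- `f : M → N` is smooth. -/
def Smooth (S : LCManifold M) (T : LCManifold N) (f : M → N) : Prop := S.SmoothOn T f univ

/-- The product manifold. -/
def prod (S : LCManifold M) (T : LCManifold N) : LCManifold (M × N) :=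
  letI := S.top
  letI := T.top
  haveI := S.t2
  haveI := T.t2
  { Model := S.Model × T.Model
    charts := {c | ∃ e ∈ S.charts, ∃ e' ∈ T.charts, c = e.prod e'}
    exists_chart := by
      rintro ⟨x, y⟩
      obtain ⟨e, he, hx⟩ := S.exists_chart x
      obtain ⟨e', he', hy⟩ := T.exists_chart y
      exact ⟨e.prod e', ⟨e, he, e', he', rfl⟩, hx, hy⟩
    compatible := by
      rintro _ ⟨e, he, e', he', rfl⟩ _ ⟨c, hc, c', hc', rfl⟩
      have h := (S.compatible e he c hc).prodMap (T.compatible e' he' c' hc')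
      have h3 : (e.prod e').target ∩ (e.prod e').symm ⁻¹' (c.prod c').source =
          (e.target ∩ e.symm ⁻¹' c.source) ×ˢ (e'.target ∩ e'.symm ⁻¹' c'.source) := by
        ext p
        simp [and_and_and_comm]
      rw [h3]
      exact h }

/-- The manifold structure makes the group `M` a Lie group. -/
def IsLieGroup [Group M] (S : LCManifold M) : Prop :=
  (S.prod S).Smooth S (fun p => p.1 * p.2) ∧ S.Smooth S (fun x => x⁻¹)

/-- The manifold `P`, with maps `p i : X → M`, has the universal property of a limit in the
category of manifolds: a map into `X` is smooth if and only if its components are. -/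
def IsSmoothLimit {X : Type u} {k : ℕ} (P : LCManifold X) (S : LCManifold M)
    (p : Fin k → X → M) : Prop :=
  (∀ i, P.Smooth S (p i)) ∧
    ∀ (Y : Type u) (T : LCManifold Y) (f : Y → X),
      (∀ i, T.Smooth S (fun y => p i (f y))) → T.Smooth P f

end LCManifold

/-- `q : P → B` is a smooth (locally trivial) principal bundle for the right action
`(x, n) ↦ x * i n` of the Lie group `N` on the Lie group `P`: the action is free, its orbits are
the fibres of `q`, and over a neighbourhood `W` of each point of `B` there are a smooth section
`σ` of `q` and a smooth map `κ` such that `(w, n) ↦ σ w * i n` and `x ↦ (q x, κ x)` are mutually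
inverse diffeomorphisms between `W × N` and `q ⁻¹' W`. -/
structure IsSmoothPrincipalBundle {N P B : Type u} [Group N] [Group P]
    (SN : LCManifold N) (SP : LCManifold P) (SB : LCManifold B) (i : N →* P) (q : P → B) :
    Prop where
  smooth_incl : SN.Smooth SP i
  smooth_proj : SP.Smooth SB q
  free : Function.Injective i
  fibre : ∀ x y, q x = q y ↔ ∃ n, y = x * i n
  locally_trivial : ∀ b : B, ∃ W : Set B, SB.Open W ∧ b ∈ W ∧ ∃ (σ : B → P) (κ : P → N),
    SB.SmoothOn SP σ W ∧ (∀ w ∈ W, q (σ w) = w) ∧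
    SP.SmoothOn SN κ (q ⁻¹' W) ∧ ∀ x ∈ q ⁻¹' W, σ (q x) * i (κ x) = x

/-- A split Lie subgroup `H` of a Lie group `G`: Lie group structure on `H` and a manifold
structure on `G ⧸ H` for which the inclusion of `H` is smooth and `G → G ⧸ H` is a smooth
principal `H`-bundle. -/
structure SplitLieSubgroup {G : Type u} [Group G] (S : LCManifold G) (H : Subgroup G) where
  sub : LCManifold H
  isLieGroup : sub.IsLieGroup
  quot : LCManifold (G ⧸ H)
  bundle : IsSmoothPrincipalBundle sub S quot H.subtype (fun x => (x : G ⧸ H))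

/-- `N → P → B` is a central extension of Lie groups. -/
structure IsCentralExtension {N P B : Type u} [Group N] [Group P] [Group B]
    (SN : LCManifold N) (SP : LCManifold P) (SB : LCManifold B) (i : N →* P) (q : P →* B) :
    Prop where
  lie_left : SN.IsLieGroup
  lie_mid : SP.IsLieGroup
  lie_right : SB.IsLieGroup
  injective : Function.Injective i
  exact : i.range = q.ker
  surjective : Function.Surjective q
  central : ∀ n x, i n * x = x * i n
  bundle : IsSmoothPrincipalBundle SN SP SB i q

/-! ## Small categories and 2-groups -/

/-- A small category, given by its set of objects, its set of all morphisms and its structure maps.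
`comp g f` is the composite `g ∘ f`; it is meaningful only if `src g = tgt f`. -/
structure SmallCat where
  Obj : Type u
  Mor : Type u
  src : Mor → Obj
  tgt : Mor → Obj
  ident : Obj → Mor
  comp : Mor → Mor → Mor
  src_ident : ∀ x, src (ident x) = x
  tgt_ident : ∀ x, tgt (ident x) = x
  src_comp : ∀ g f, src g = tgt f → src (comp g f) = src f
  tgt_comp : ∀ g f, src g = tgt f → tgt (comp g f) = tgt g
  comp_ident : ∀ f, comp f (ident (src f)) = f
  ident_comp : ∀ f, comp (ident (tgt f)) f = f
  comp_assoc : ∀ h g f, src h = tgt g → src g = tgt f →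
    comp (comp h g) f = comp h (comp g f)

namespace SmallCat

variable (C : SmallCat.{u})

/-- The set of composable pairs of morphisms. -/
def Pairs : Type u := {p : C.Mor × C.Mor // C.src p.1 = C.tgt p.2}

/-- The set of composable triples of morphisms. -/
def Triples : Type u :=
  {p : C.Mor × C.Mor × C.Mor // C.src p.1 = C.tgt p.2.1 ∧ C.src p.2.1 = C.tgt p.2.2}

/-- The morphism `f` is invertible. -/
def Invertible (f : C.Mor) : Prop :=
  ∃ g, C.src g = C.tgt f ∧ C.tgt g = C.src f ∧
    C.comp g f = C.ident (C.src f) ∧ C.comp f g = C.ident (C.tgt f)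

/-- The objects `x` and `y` are isomorphic. -/
def Isomorphic (x y : C.Obj) : Prop := ∃ f, C.src f = x ∧ C.tgt f = y ∧ C.Invertible f

theorem Isomorphic.refl (x : C.Obj) : C.Isomorphic x x := by
  refine ⟨C.ident x, C.src_ident x, C.tgt_ident x, C.ident x, ?_, ?_, ?_, ?_⟩
  · rw [C.src_ident, C.tgt_ident]
  · rw [C.src_ident, C.tgt_ident]
  · simpa only [C.src_ident] using C.comp_ident (C.ident x)
  · simpa only [C.src_ident, C.tgt_ident] using C.comp_ident (C.ident x)

variable {C}

theorem Isomorphic.symm {x y : C.Obj} (h : C.Isomorphic x y) : C.Isomorphic y x := by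
  obtain ⟨f, rfl, rfl, g, h1, h2, h3, h4⟩ := h
  exact ⟨g, h1, h2, f, h2.symm, h1.symm, by rw [h1, h4], by rw [h2, h3]⟩

theorem Isomorphic.trans {x y z : C.Obj} (h : C.Isomorphic x y) (h' : C.Isomorphic y z) :
    C.Isomorphic x z := by
  obtain ⟨f, rfl, rfl, g, h1, h2, h3, h4⟩ := h
  obtain ⟨f', e, rfl, g', h1', h2', h3', h4'⟩ := h'
  have e2 : C.src g = C.tgt g' := by rw [h1, h2', e]
  refine ⟨C.comp f' f, C.src_comp _ _ e, C.tgt_comp _ _ e, C.comp g g', ?_, ?_, ?_, ?_⟩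
  · rw [C.src_comp _ _ e2, C.tgt_comp _ _ e, h1']
  · rw [C.tgt_comp _ _ e2, C.src_comp _ _ e, h2]
  · rw [C.src_comp _ _ e, C.comp_assoc _ _ _ e2 (by rw [h1', C.tgt_comp _ _ e]),
      ← C.comp_assoc _ _ _ h1' e, h3', e, C.ident_comp, h3]
  · rw [C.tgt_comp _ _ e, C.comp_assoc _ _ _ e (by rw [C.tgt_comp _ _ e2, h2]),
      ← C.comp_assoc _ _ _ h2.symm e2, h4, ← e, ← h2', C.ident_comp, h4']

/-- The setoid of isomorphic objects. -/
def isoSetoid (C : SmallCat.{u}) : Setoid C.Obj :=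
  ⟨C.Isomorphic, ⟨Isomorphic.refl C, Isomorphic.symm, Isomorphic.trans⟩⟩

/-- The sets `U₀` of objects and `U₁` of morphisms form an open subcategory. -/
structure IsOpenSubcat (C : SmallCat.{u}) (S₀ : LCManifold C.Obj) (S₁ : LCManifold C.Mor)
    (U₀ : Set C.Obj) (U₁ : Set C.Mor) : Prop where
  open_obj : S₀.Open U₀
  open_mor : S₁.Open U₁
  src_mem : ∀ f ∈ U₁, C.src f ∈ U₀
  tgt_mem : ∀ f ∈ U₁, C.tgt f ∈ U₀
  ident_mem : ∀ x ∈ U₀, C.ident x ∈ U₁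
  comp_mem : ∀ g ∈ U₁, ∀ f ∈ U₁, C.src g = C.tgt f → C.comp g f ∈ U₁

/-- A smooth 2-space: a category internal to manifolds. The sets of composable pairs and triples
are required to be manifolds, as fibre products in the category of manifolds; smoothness of maps
into these sets is then smoothness of the components. -/
structure IsSmoothTwoSpace (C : SmallCat.{u}) (S₀ : LCManifold C.Obj) (S₁ : LCManifold C.Mor) :
    Prop where
  smooth_src : S₁.Smooth S₀ C.src
  smooth_tgt : S₁.Smooth S₀ C.tgt
  smooth_ident : S₀.Smooth S₁ C.ident
  pairs : ∃ P : LCManifold C.Pairs,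
    P.IsSmoothLimit S₁ ![fun p => p.1.1, fun p => p.1.2] ∧
    P.Smooth S₁ (fun p => C.comp p.1.1 p.1.2)
  triples : ∃ T : LCManifold C.Triples,
    T.IsSmoothLimit S₁ ![fun p => p.1.1, fun p => p.1.2.1, fun p => p.1.2.2]

end SmallCat

/-- A (unital) 2-group. -/
structure TwoGroup extends SmallCat.{u} where
  /-- the multiplication functor on objects and on morphisms -/
  tensObj : Obj → Obj → Obj
  tens : Mor → Mor → Mor
  src_tens : ∀ f g, src (tens f g) = tensObj (src f) (src g)
  tgt_tens : ∀ f g, tgt (tens f g) = tensObj (tgt f) (tgt g)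
  tens_ident : ∀ x y, tens (ident x) (ident y) = ident (tensObj x y)
  tens_comp : ∀ f f' g g', src f' = tgt f → src g' = tgt g →
    tens (comp f' f) (comp g' g) = comp (tens f' g') (tens f g)
  /-- the inversion functor on objects and on morphisms -/
  barObj : Obj → Obj
  bar : Mor → Mor
  src_bar : ∀ f, src (bar f) = barObj (src f)
  tgt_bar : ∀ f, tgt (bar f) = barObj (tgt f)
  bar_ident : ∀ x, bar (ident x) = ident (barObj x)
  bar_comp : ∀ g f, src g = tgt f → bar (comp g f) = comp (bar g) (bar f)
  /-- the unit object -/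
  unit : Obj
  /-- the associator, a natural isomorphism -/
  assoc : Obj → Obj → Obj → Mor
  src_assoc : ∀ x y z, src (assoc x y z) = tensObj (tensObj x y) z
  tgt_assoc : ∀ x y z, tgt (assoc x y z) = tensObj x (tensObj y z)
  assoc_natural : ∀ f g h,
    comp (assoc (tgt f) (tgt g) (tgt h)) (tens (tens f g) h) =
      comp (tens f (tens g h)) (assoc (src f) (src g) (src h))
  assoc_invertible : ∀ x y z, toSmallCat.Invertible (assoc x y z)
  /-- strict unit and inverse laws on objects and morphisms -/
  tensObj_unit : ∀ x, tensObj x unit = x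
  unit_tensObj : ∀ x, tensObj unit x = x
  tens_unit : ∀ f, tens f (ident unit) = f
  unit_tens : ∀ f, tens (ident unit) f = f
  tensObj_bar : ∀ x, tensObj x (barObj x) = unit
  bar_tensObj : ∀ x, tensObj (barObj x) x = unit
  tens_bar : ∀ f, tens f (bar f) = ident unit
  bar_tens : ∀ f, tens (bar f) f = ident unit
  /-- coherence -/
  pentagon : ∀ x y z w,
    comp (assoc x y (tensObj z w)) (assoc (tensObj x y) z w) =
      comp (tens (ident x) (assoc y z w))
        (comp (assoc x (tensObj y z) w) (tens (assoc x y z) (ident w)))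
  assoc_unit_left : ∀ y z, assoc unit y z = ident (tensObj y z)
  assoc_unit_mid : ∀ x z, assoc x unit z = ident (tensObj x z)
  assoc_unit_right : ∀ x y, assoc x y unit = ident (tensObj x y)
  assoc_bar : ∀ x, assoc x (barObj x) x = ident x
  assoc_bar' : ∀ x, assoc (barObj x) x (barObj x) = ident (barObj x)

namespace TwoGroup

theorem tens_isomorphic (𝒢 : TwoGroup.{u}) {x x' y y' : 𝒢.Obj}
    (h : 𝒢.Isomorphic x x') (h' : 𝒢.Isomorphic y y') :
    𝒢.Isomorphic (𝒢.tensObj x y) (𝒢.tensObj x' y') := by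
  obtain ⟨f, rfl, rfl, g, h1, h2, h3, h4⟩ := h
  obtain ⟨f', rfl, rfl, g', h1', h2', h3', h4'⟩ := h'
  refine ⟨𝒢.tens f f', 𝒢.src_tens _ _, 𝒢.tgt_tens _ _, 𝒢.tens g g', ?_, ?_, ?_, ?_⟩
  · rw [𝒢.src_tens, 𝒢.tgt_tens, h1, h1']
  · rw [𝒢.src_tens, 𝒢.tgt_tens, h2, h2']
  · rw [← 𝒢.tens_comp _ _ _ _ h1 h1', h3, h3', 𝒢.tens_ident, 𝒢.src_tens]
  · rw [← 𝒢.tens_comp _ _ _ _ h2.symm h2'.symm, h4, h4', 𝒢.tens_ident, 𝒢.tgt_tens]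

theorem bar_isomorphic (𝒢 : TwoGroup.{u}) {x x' : 𝒢.Obj} (h : 𝒢.Isomorphic x x') :
    𝒢.Isomorphic (𝒢.barObj x) (𝒢.barObj x') := by
  obtain ⟨f, rfl, rfl, g, h1, h2, h3, h4⟩ := h
  refine ⟨𝒢.bar f, 𝒢.src_bar _, 𝒢.tgt_bar _, 𝒢.bar g, ?_, ?_, ?_, ?_⟩
  · rw [𝒢.src_bar, 𝒢.tgt_bar, h1]
  · rw [𝒢.src_bar, 𝒢.tgt_bar, h2]
  · rw [← 𝒢.bar_comp _ _ h1, h3, 𝒢.bar_ident, 𝒢.src_bar]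
  · rw [← 𝒢.bar_comp _ _ h2.symm, h4, 𝒢.bar_ident, 𝒢.tgt_bar]

/-- The set of isomorphism classes of objects. -/
def Skel (𝒢 : TwoGroup.{u}) : Type u := Quotient 𝒢.isoSetoid

/-- The isomorphism class of an object. -/
def cls (𝒢 : TwoGroup.{u}) (x : 𝒢.Obj) : 𝒢.Skel := Quotient.mk 𝒢.isoSetoid x

/-- The group structure on isomorphism classes, induced by the group functors. -/
instance (𝒢 : TwoGroup.{u}) : Group 𝒢.Skel where
  mul := Quotient.map₂ 𝒢.tensObj fun _ _ h _ _ h' => 𝒢.tens_isomorphic h h'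
  one := 𝒢.cls 𝒢.unit
  inv := Quotient.map 𝒢.barObj fun _ _ h => 𝒢.bar_isomorphic h
  mul_assoc := by
    rintro ⟨x⟩ ⟨y⟩ ⟨z⟩
    exact Quotient.sound ⟨𝒢.assoc x y z, 𝒢.src_assoc x y z, 𝒢.tgt_assoc x y z,
      𝒢.assoc_invertible x y z⟩
  one_mul := by
    rintro ⟨x⟩
    exact congrArg 𝒢.cls (𝒢.unit_tensObj x)
  mul_one := by
    rintro ⟨x⟩
    exact congrArg 𝒢.cls (𝒢.tensObj_unit x)
  inv_mul_cancel := by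
    rintro ⟨x⟩
    exact congrArg 𝒢.cls (𝒢.bar_tensObj x)

/-- The strict abelian 2-group of an abelian crossed module `τ : A → Z` (trivial action). A
morphism `(a, z)` goes from `z` to `τ a * z`. -/
def ofAbelian {A Z : Type u} [CommGroup A] [CommGroup Z] (τ : A →* Z) : TwoGroup.{u} where
  Obj := Z
  Mor := A × Z
  src f := f.2
  tgt f := τ f.1 * f.2
  ident z := (1, z)
  comp g f := (g.1 * f.1, f.2)
  src_ident _ := rfl
  tgt_ident _ := by simp
  src_comp _ _ _ := rfl
  tgt_comp g f h := by simp [show g.2 = τ f.1 * f.2 from h, mul_assoc]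
  comp_ident f := by simp
  ident_comp f := by simp
  comp_assoc h g f _ _ := by simp [mul_assoc]
  tensObj x y := x * y
  tens f g := f * g
  src_tens _ _ := rfl
  tgt_tens f g := by simp [mul_mul_mul_comm]
  tens_ident x y := by simp
  tens_comp f f' g g' _ _ := by ext <;> simp [mul_mul_mul_comm]
  barObj x := x⁻¹
  bar f := f⁻¹
  src_bar _ := rfl
  tgt_bar f := by simp [mul_comm]
  bar_ident x := by ext <;> simp
  bar_comp g f _ := by ext <;> simp [mul_comm]
  unit := 1
  assoc x y z := (1, x * y * z)
  src_assoc _ _ _ := rfl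
  tgt_assoc x y z := by simp [mul_assoc]
  assoc_natural f g h := by ext <;> simp [mul_assoc]
  assoc_invertible x y z := ⟨(1, x * y * z), by simp⟩
  tensObj_unit := mul_one
  unit_tensObj := one_mul
  tens_unit f := by ext <;> simp
  unit_tens f := by ext <;> simp
  tensObj_bar := mul_inv_cancel
  bar_tensObj := inv_mul_cancel
  tens_bar f := by ext <;> simp
  bar_tens f := by ext <;> simp
  pentagon x y z w := by ext <;> simp [mul_assoc]
  assoc_unit_left y z := by simp
  assoc_unit_mid x z := by simp
  assoc_unit_right x y := by simp
  assoc_bar x := by simp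
  assoc_bar' x := by simp

/-- The group `G`, regarded as a 2-group with only identity morphisms (the morphism `g` is the
identity of the object `g`). -/
def ofGroup (G : Type u) [Group G] : TwoGroup.{u} where
  Obj := G
  Mor := G
  src g := g
  tgt g := g
  ident g := g
  comp g _ := g
  src_ident _ := rfl
  tgt_ident _ := rfl
  src_comp _ _ h := h
  tgt_comp _ _ _ := rfl
  comp_ident _ := rfl
  ident_comp _ := rfl
  comp_assoc _ _ _ _ _ := rfl
  tensObj x y := x * y
  tens f g := f * g
  src_tens _ _ := rfl
  tgt_tens _ _ := rfl
  tens_ident _ _ := rfl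
  tens_comp _ _ _ _ _ _ := rfl
  barObj x := x⁻¹
  bar f := f⁻¹
  src_bar _ := rfl
  tgt_bar _ := rfl
  bar_ident _ := rfl
  bar_comp _ _ _ := rfl
  unit := 1
  assoc x y z := x * y * z
  src_assoc _ _ _ := rfl
  tgt_assoc := mul_assoc
  assoc_natural := mul_assoc
  assoc_invertible x y z := ⟨x * y * z, rfl, rfl, rfl, rfl⟩
  tensObj_unit := mul_one
  unit_tensObj := one_mul
  tens_unit := mul_one
  unit_tens := one_mul
  tensObj_bar := mul_inv_cancel
  bar_tensObj := inv_mul_cancel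
  tens_bar := mul_inv_cancel
  bar_tens := inv_mul_cancel
  pentagon x y z w := by simp [mul_assoc]
  assoc_unit_left y z := by simp
  assoc_unit_mid x z := by simp
  assoc_unit_right x y := by simp
  assoc_bar x := by simp
  assoc_bar' x := by simp

/-- The group of isomorphism classes of `ofGroup G` is `G`. -/
def skelOfGroup (G : Type u) [Group G] : (ofGroup G).Skel ≃* G where
  toFun := Quotient.lift (fun g : G => g) (by
    rintro x y ⟨f, hx, hy, -⟩
    exact hx.symm.trans hy)
  invFun := (ofGroup G).cls
  left_inv := by rintro ⟨x⟩; rfl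
  right_inv _ := rfl
  map_mul' := by rintro ⟨x⟩ ⟨y⟩; rfl

/-- A morphism of 2-groups: a functor `(obj, mor)` with natural isomorphisms
`mu x y : F x ⊗ F y → F (x ⊗ y)`. -/
structure Hom (𝒢 ℋ : TwoGroup.{u}) where
  obj : 𝒢.Obj → ℋ.Obj
  mor : 𝒢.Mor → ℋ.Mor
  src_mor : ∀ f, ℋ.src (mor f) = obj (𝒢.src f)
  tgt_mor : ∀ f, ℋ.tgt (mor f) = obj (𝒢.tgt f)
  mor_ident : ∀ x, mor (𝒢.ident x) = ℋ.ident (obj x)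
  mor_comp : ∀ g f, 𝒢.src g = 𝒢.tgt f → mor (𝒢.comp g f) = ℋ.comp (mor g) (mor f)
  mu : 𝒢.Obj → 𝒢.Obj → ℋ.Mor
  src_mu : ∀ x y, ℋ.src (mu x y) = ℋ.tensObj (obj x) (obj y)
  tgt_mu : ∀ x y, ℋ.tgt (mu x y) = obj (𝒢.tensObj x y)
  mu_natural : ∀ f g, ℋ.comp (mu (𝒢.tgt f) (𝒢.tgt g)) (ℋ.tens (mor f) (mor g)) =
    ℋ.comp (mor (𝒢.tens f g)) (mu (𝒢.src f) (𝒢.src g))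
  mu_invertible : ∀ x y, ℋ.Invertible (mu x y)
  obj_unit : obj 𝒢.unit = ℋ.unit
  mu_unit : ∀ x, mu x 𝒢.unit = ℋ.ident (obj x)
  unit_mu : ∀ x, mu 𝒢.unit x = ℋ.ident (obj x)
  mu_bar : ∀ x, mu x (𝒢.barObj x) = ℋ.ident ℋ.unit
  bar_mu : ∀ x, mu (𝒢.barObj x) x = ℋ.ident ℋ.unit
  coherence : ∀ x y z,
    ℋ.comp (mu x (𝒢.tensObj y z))
      (ℋ.comp (ℋ.tens (ℋ.ident (obj x)) (mu y z)) (ℋ.assoc (obj x) (obj y) (obj z))) =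
    ℋ.comp (mor (𝒢.assoc x y z))
      (ℋ.comp (mu (𝒢.tensObj x y) z) (ℋ.tens (mu x y) (ℋ.ident (obj z))))

/-- The homomorphism induced by a morphism of 2-groups on groups of isomorphism classes. -/
def Hom.skel {𝒢 ℋ : TwoGroup.{u}} (F : Hom 𝒢 ℋ) : 𝒢.Skel →* ℋ.Skel :=
  MonoidHom.mk'
    (Quotient.map F.obj (by
      rintro x y ⟨f, rfl, rfl, g, h1, h2, h3, h4⟩
      refine ⟨F.mor f, F.src_mor f, F.tgt_mor f, F.mor g, ?_, ?_, ?_, ?_⟩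
      · rw [F.src_mor, F.tgt_mor, h1]
      · rw [F.src_mor, F.tgt_mor, h2]
      · rw [← F.mor_comp _ _ h1, h3, F.mor_ident, F.src_mor]
      · rw [← F.mor_comp _ _ h2.symm, h4, F.mor_ident, F.tgt_mor]))
    (by
      rintro ⟨x⟩ ⟨y⟩
      exact (Quotient.sound ⟨F.mu x y, F.src_mu x y, F.tgt_mu x y, F.mu_invertible x y⟩ :
        ℋ.cls (ℋ.tensObj (F.obj x) (F.obj y)) = ℋ.cls (F.obj (𝒢.tensObj x y))).symm)

/-! ## Lie 2-groups and smooth generalised central extensions -/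

/-- The manifold structures on objects and morphisms make `𝒢` a Lie 2-group: the underlying
category is a smooth 2-space, and the group functors and the associator are smooth on some open
subcategory that contains the unit. -/
structure IsLie (𝒢 : TwoGroup.{u}) (S₀ : LCManifold 𝒢.Obj) (S₁ : LCManifold 𝒢.Mor) :
    Prop where
  twoSpace : 𝒢.IsSmoothTwoSpace S₀ S₁
  locally_smooth : ∃ (U₀ : Set 𝒢.Obj) (U₁ : Set 𝒢.Mor),
    𝒢.IsOpenSubcat S₀ S₁ U₀ U₁ ∧ 𝒢.unit ∈ U₀ ∧
    (S₀.prod S₀).SmoothOn S₀ (fun p => 𝒢.tensObj p.1 p.2) (U₀ ×ˢ U₀) ∧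
    (S₁.prod S₁).SmoothOn S₁ (fun p => 𝒢.tens p.1 p.2) (U₁ ×ˢ U₁) ∧
    S₀.SmoothOn S₀ 𝒢.barObj U₀ ∧
    S₁.SmoothOn S₁ 𝒢.bar U₁ ∧
    (S₀.prod (S₀.prod S₀)).SmoothOn S₁ (fun p => 𝒢.assoc p.1 p.2.1 p.2.2) (U₀ ×ˢ U₀ ×ˢ U₀)

/-- A morphism of 2-groups is a morphism of Lie 2-groups if it is smooth on some open subcategory
that contains the unit. -/
def Hom.IsLie {𝒢 ℋ : TwoGroup.{u}} (F : Hom 𝒢 ℋ) (S₀ : LCManifold 𝒢.Obj)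
    (S₁ : LCManifold 𝒢.Mor) (T₀ : LCManifold ℋ.Obj) (T₁ : LCManifold ℋ.Mor) : Prop :=
  ∃ (U₀ : Set 𝒢.Obj) (U₁ : Set 𝒢.Mor), 𝒢.IsOpenSubcat S₀ S₁ U₀ U₁ ∧ 𝒢.unit ∈ U₀ ∧
    S₀.SmoothOn T₀ F.obj U₀ ∧ S₁.SmoothOn T₁ F.mor U₁ ∧
    (S₀.prod S₀).SmoothOn T₁ (fun p => F.mu p.1 p.2) (U₀ ×ˢ U₀)

end TwoGroup

/-- `𝒵_τ → 𝒢 → G` is a generalised central extension: a central, short exact sequence of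
2-groups. -/
structure IsGenCentralExtension {A Z G : Type u} [CommGroup A] [CommGroup Z] [Group G]
    {τ : A →* Z} {𝒢 : TwoGroup.{u}} (ι : TwoGroup.Hom (TwoGroup.ofAbelian τ) 𝒢)
    (q : TwoGroup.Hom 𝒢 (TwoGroup.ofGroup G)) : Prop where
  central : ∀ a g, 𝒢.tens (ι.mor a) g = 𝒢.tens g (ι.mor a)
  injective : Function.Injective ι.mor
  exact : ∀ g, g ∈ range ι.mor ↔ q.mor g = (TwoGroup.ofGroup G).ident (TwoGroup.ofGroup G).unit
  surjective : Function.Surjective q.mor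

/-- A smooth generalised central extension of the Lie group `G` by the strict abelian Lie 2-group
`𝒵_τ`, `τ : A → Z`, with `A` discrete. -/
structure IsSmoothGenCentralExtension {A Z G : Type u} [CommGroup A] [CommGroup Z] [Group G]
    {τ : A →* Z} {𝒢 : TwoGroup.{u}} (SA : LCManifold A) (SZ : LCManifold Z) (SG : LCManifold G)
    (S₀ : LCManifold 𝒢.Obj) (S₁ : LCManifold 𝒢.Mor)
    (ι : TwoGroup.Hom (TwoGroup.ofAbelian τ) 𝒢)
    (q : TwoGroup.Hom 𝒢 (TwoGroup.ofGroup G)) : Prop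
    extends IsGenCentralExtension ι q where
  lie_A : SA.IsLieGroup
  lie_Z : SZ.IsLieGroup
  smooth_tau : SA.Smooth SZ τ
  discrete_A : @DiscreteTopology A SA.top
  lie_G : SG.IsLieGroup
  lie_mid : 𝒢.IsLie S₀ S₁
  lie_incl : ι.IsLie SZ (SA.prod SZ) S₀ S₁
  lie_proj : q.IsLie S₀ S₁ SG SG
  /-- exactness in the smooth sense: near the unit, the inverse of `ι : Z → ι(Z)` is smooth, that
  is, it is the restriction of a smooth map on an open subset of the manifold of objects -/
  embedding : ∃ (N : Set 𝒢.Obj) (r : 𝒢.Obj → Z), S₀.Open N ∧ 𝒢.unit ∈ N ∧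
    S₀.SmoothOn SZ r N ∧ ∀ z : Z, ι.obj z ∈ N → r (ι.obj z) = z
  /-- a smooth section over a unit neighbourhood; a functor on a category with only identity
  morphisms is determined by its values on objects -/
  sect : ∃ (U : Set G) (s : G → 𝒢.Obj), SG.Open U ∧ 1 ∈ U ∧ s 1 = 𝒢.unit ∧
    SG.SmoothOn S₀ s U ∧ ∀ g ∈ U, q.obj (s g) = g

/-- The manifold structure `T` on the group of isomorphism classes is a Lie group structure which
is induced by the manifold of objects: near the unit, the projection that sends an object to its
isomorphism class is smooth and has a smooth section. -/
def IsNaturalLieStructure (𝒢 : TwoGroup.{u}) (S₀ : LCManifold 𝒢.Obj) (T : LCManifold 𝒢.Skel) :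
    Prop :=
  T.IsLieGroup ∧
  (∃ U : Set 𝒢.Obj, S₀.Open U ∧ 𝒢.unit ∈ U ∧ S₀.SmoothOn T 𝒢.cls U) ∧
  ∃ (V : Set 𝒢.Skel) (σ : 𝒢.Skel → 𝒢.Obj), T.Open V ∧ 1 ∈ V ∧ T.SmoothOn S₀ σ V ∧
    σ 1 = 𝒢.unit ∧ ∀ v ∈ V, 𝒢.cls (σ v) = v

/-!
On isomorphism classes, a generalised central extension gives a central extension of groups
`skel 𝒵 → skel 𝒢 → G`, and `skel 𝒵` is `Z ⧸ τ(A)` (`TwoGroup.skelAbelianEquiv`), whose Lie group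
structure comes from the split subgroup `τ(A)`. A section `s` of `q` that is smooth near the unit
induces a section `σ = cls ∘ s` of `skel 𝒢 → G`. Its cocycle at `(g, h)` is the class of the element
`z` of `Z` with `ι z = (s g ⊗ s h) ⊗ bar (s (g h))`; it is smooth near the unit since the inverse of
`ι` is (`IsSmoothGenCentralExtension.smoothAt_cocycle`).

The rest is a statement on a central extension `N → H → G` of abstract groups with Lie groups `N`
and `G` and a cocycle that is smooth on `W × W` for an open unit neighbourhood `W`. The maps
`(w, n) ↦ h σ(w) i(n)` on `W × N`, for all `h` in `H`, have smooth transition maps, by an explicit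
formula in terms of the cocycle (`SectionedExtension.κ_mul_σ`), so they define a manifold structure
with smooth left translations (`SectionedExtension.exists_isAdapted`). Multiplication and inversion
are smooth near the unit, again by explicit formulas. Conjugations are smooth near the unit for
elements over `W`, hence for all elements, because `W` generates the connected group `G` and `N` is
central. These properties imply that `H` is a Lie group (`SectionedExtension.IsAdapted.isLieGroup`),
and the maps above are local trivialisations of `H → G`.

For the middle group the projection from objects is smooth near the unit because its coordinates are
`q` and the class of `ι⁻¹(x ⊗ bar (s (q x)))`, and `σ(g) i(n) ↦ s(g) ⊗ ι(ζ(n))`, with a local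
section `ζ` of `Z → skel 𝒵`, is a section. Two natural structures agree because near the unit the
identity is a section for the first followed by the projection for the second
(`IsNaturalLieStructure.smooth_id`).

Smoothness on manifolds rests on the chain rule `BContDiffOn.comp` for Michal–Bastiani maps. It is
proved by a mean value theorem in locally convex spaces, which follows from the Hahn–Banach theorem.
-/

/-! ### The chain rule for Michal–Bastiani maps -/

section Calculus

variable {E F H : Type u} [AddCommGroup E] [Module ℝ E] [TopologicalSpace E]
  [AddCommGroup F] [Module ℝ F] [TopologicalSpace F]
  [AddCommGroup H] [Module ℝ H] [TopologicalSpace H]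

theorem BContDiffOn.mono {n : ℕ} : ∀ {E : Type u} [AddCommGroup E] [Module ℝ E]
    [TopologicalSpace E] {f : E → F} {U V : Set E}, BContDiffOn n f U → V ⊆ U →
      BContDiffOn n f V := by
  induction n with
  | zero => intro E _ _ _ f U V hf hV; exact ContinuousOn.mono hf hV
  | succ n ih =>
    rintro E _ _ _ f U V ⟨hc, df, hd, hn⟩ hV
    exact ⟨hc.mono hV, df, fun x hx => hd x (hV hx), ih hn (prod_mono hV subset_rfl)⟩

theorem BContDiffOn.continuousOn {n : ℕ} {f : E → F} {U : Set E} (hf : BContDiffOn n f U) :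
    ContinuousOn f U := by
  cases n with
  | zero => exact hf
  | succ n => exact hf.1

theorem BContDiffOn.of_succ {n : ℕ} : ∀ {E : Type u} [AddCommGroup E] [Module ℝ E]
    [TopologicalSpace E] {f : E → F} {U : Set E}, BContDiffOn (n + 1) f U →
      BContDiffOn n f U := by
  induction n with
  | zero => intro E _ _ _ f U hf; exact hf.1
  | succ n ih =>
    rintro E _ _ _ f U ⟨hc, df, hd, hn⟩
    exact ⟨hc, df, hd, ih hn⟩

/-- A line through a point of an open set stays in this set for small times. -/
theorem eventually_line_mem [ContinuousAdd E] [ContinuousSMul ℝ E] {U : Set E} (hU : IsOpen U)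
    {x : E} (hx : x ∈ U) (v : E) : ∀ᶠ h : ℝ in 𝓝[≠] 0, x + h • v ∈ U := by
  have h1 : Tendsto (fun h : ℝ => x + h • v) (𝓝 0) (𝓝 (x + (0 : ℝ) • v)) :=
    Continuous.tendsto (by fun_prop) 0
  rw [zero_smul, add_zero] at h1
  exact nhdsWithin_le_nhds (h1 (hU.mem_nhds hx))

theorem BContDiffOn.congr [ContinuousAdd E] [ContinuousSMul ℝ E] {n : ℕ} {f g : E → F}
    {U : Set E} (hU : IsOpen U) (hf : BContDiffOn n f U) (hfg : EqOn g f U) :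
    BContDiffOn n g U := by
  cases n with
  | zero => exact ContinuousOn.congr hf hfg
  | succ n =>
    obtain ⟨hc, df, hd, hn⟩ := hf
    refine ⟨hc.congr hfg, df, fun x hx v => (hd x hx v).congr' ?_, hn⟩
    filter_upwards [eventually_line_mem hU hx v] with h hh
    rw [hfg hh, hfg hx]

/-- Being of class `C^n` is a local property: the local directional derivatives agree on overlaps
because limits in a Hausdorff space are unique. -/
theorem BContDiffOn.of_locally [T2Space F] {n : ℕ} : ∀ {E : Type u} [AddCommGroup E] [Module ℝ E]
    [TopologicalSpace E] [ContinuousAdd E] [ContinuousSMul ℝ E] {f : E → F} {U : Set E},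
    (∀ x ∈ U, ∃ V, IsOpen V ∧ x ∈ V ∧ BContDiffOn n f V) → BContDiffOn n f U := by
  have key : ∀ {m : ℕ} {E : Type u} [AddCommGroup E] [Module ℝ E] [TopologicalSpace E] {f : E → F}
      {U : Set E}, (∀ x ∈ U, ∃ V, IsOpen V ∧ x ∈ V ∧ BContDiffOn m f V) → ContinuousOn f U := by
    intro m E _ _ _ f U h x hx
    obtain ⟨V, hV, hxV, hf⟩ := h x hx
    exact (hf.continuousOn.continuousAt (hV.mem_nhds hxV)).continuousWithinAt
  induction n with
  | zero => intro E _ _ _ _ _ f U h; exact key h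
  | succ n ih =>
    intro E _ _ _ _ _ f U h
    classical
    let df : E × E → F := fun p =>
      if h : ∃ y, Tendsto (fun h : ℝ => h⁻¹ • (f (p.1 + h • p.2) - f p.1)) (𝓝[≠] 0) (𝓝 y)
      then h.choose else 0
    have hdf : ∀ x v y, Tendsto (fun h : ℝ => h⁻¹ • (f (x + h • v) - f x)) (𝓝[≠] 0) (𝓝 y) →
        df (x, v) = y := by
      intro x v y hy
      have hex : ∃ y, Tendsto (fun h : ℝ => h⁻¹ • (f (x + h • v) - f x)) (𝓝[≠] 0) (𝓝 y) :=
        ⟨y, hy⟩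
      have : df (x, v) = hex.choose := dif_pos hex
      rw [this]
      exact tendsto_nhds_unique hex.choose_spec hy
    refine ⟨key h, df, ?_, ih ?_⟩
    · intro x hx v
      obtain ⟨V, hV, hxV, hc, df', hd, hn⟩ := h x hx
      rw [hdf x v _ (hd x hxV v)]
      exact hd x hxV v
    · rintro ⟨x, v⟩ ⟨hx, -⟩
      obtain ⟨V, hV, hxV, hc, df', hd, hn⟩ := h x hx
      refine ⟨V ×ˢ univ, hV.prod isOpen_univ, ⟨hxV, mem_univ v⟩,
        hn.congr (hV.prod isOpen_univ) ?_⟩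
      rintro ⟨y, w⟩ ⟨hy, -⟩
      exact hdf y w _ (hd y hy w)

theorem BContDiffOn.const {n : ℕ} : ∀ {E : Type u} [AddCommGroup E] [Module ℝ E]
    [TopologicalSpace E] (c : F) (U : Set E), BContDiffOn n (fun _ : E => c) U := by
  induction n generalizing F with
  | zero => intro E _ _ _ c U; exact continuousOn_const
  | succ n ih =>
    intro E _ _ _ c U
    exact ⟨continuousOn_const, fun _ => 0, fun x _ v => by
      simpa using tendsto_const_nhds, ih 0 _⟩

theorem ContinuousLinearMap.bContDiffOn {n : ℕ} : ∀ {E : Type u} [AddCommGroup E] [Module ℝ E]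
    [TopologicalSpace E] (L : E →L[ℝ] F) (U : Set E), BContDiffOn n L U := by
  induction n with
  | zero => intro E _ _ _ L U; exact L.continuous.continuousOn
  | succ n ih =>
    intro E _ _ _ L U
    refine ⟨L.continuous.continuousOn, L.comp (ContinuousLinearMap.snd ℝ E E), fun x _ v => ?_,
      ih _ _⟩
    refine tendsto_const_nhds.congr' ?_
    filter_upwards [self_mem_nhdsWithin] with h hh
    simp [inv_smul_smul₀ hh]

theorem BContDiffOn.prodMk {F' : Type u} [AddCommGroup F'] [Module ℝ F'] [TopologicalSpace F']
    {n : ℕ} {f : E → F} {f' : E → F'} {U : Set E} (hf : BContDiffOn n f U)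
    (hf' : BContDiffOn n f' U) : BContDiffOn n (fun x => (f x, f' x)) U := by
  have := BContDiffOn.prod_comp n (ContinuousLinearMap.id ℝ E) (ContinuousLinearMap.id ℝ E) hf hf'
  simpa using this

/-- Mean value theorem in a locally convex space: the increment of a curve over the unit interval
lies in every closed convex set that contains its velocities. By the Hahn–Banach theorem this
reduces to real-valued functions. -/
theorem sub_mem_of_velocity_mem [IsTopologicalAddGroup F] [ContinuousSMul ℝ F]
    [LocallyConvexSpace ℝ F] {γ γ' : ℝ → F} {C : Set F} (hC : Convex ℝ C) (hC' : IsClosed C)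
    (hd : ∀ s ∈ Icc (0 : ℝ) 1,
      Tendsto (fun t : ℝ => t⁻¹ • (γ (s + t) - γ s)) (𝓝[≠] 0) (𝓝 (γ' s)))
    (hm : ∀ s ∈ Icc (0 : ℝ) 1, γ' s ∈ C) : γ 1 - γ 0 ∈ C := by
  by_contra hcon
  obtain ⟨l, u, hl, hu⟩ := geometric_hahn_banach_closed_point hC hC' hcon
  have hder : ∀ s ∈ Icc (0 : ℝ) 1, HasDerivAt (fun t => l (γ t)) (l (γ' s)) s := by
    intro s hs
    rw [hasDerivAt_iff_tendsto_slope_zero]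
    have := (l.continuous.tendsto _).comp (hd s hs)
    simpa [Function.comp_def] using this
  obtain ⟨c, hc, hc'⟩ := exists_hasDerivAt_eq_slope (fun t => l (γ t)) (fun s => l (γ' s))
    zero_lt_one (fun s hs => (hder s hs).continuousAt.continuousWithinAt)
    (fun s hs => hder s (Ioo_subset_Icc_self hs))
  have h1 := hl _ (hm c (Ioo_subset_Icc_self hc))
  rw [map_sub] at hu
  simp only [sub_zero, div_one] at hc'
  linarith

theorem exists_closed_convex_nhds [IsTopologicalAddGroup F] [ContinuousSMul ℝ F]
    [LocallyConvexSpace ℝ F] {y : F} {O : Set F} (hO : O ∈ 𝓝 y) :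
    ∃ C ∈ 𝓝 y, Convex ℝ C ∧ IsClosed C ∧ C ⊆ O := by
  obtain ⟨C', hC', hcl, hsub⟩ := exists_mem_nhds_isClosed_subset hO
  obtain ⟨D, ⟨hD, hDc⟩, hDs⟩ := (LocallyConvexSpace.convex_basis (𝕜 := ℝ) y).mem_iff.1 hC'
  exact ⟨closure D, mem_of_superset hD subset_closure, hDc.closure, isClosed_closure,
    (closure_minimal hDs hcl).trans hsub⟩

/-- The chain rule for directional derivatives. -/
theorem tendsto_comp_slope [ContinuousAdd E] [ContinuousSMul ℝ E]
    [IsTopologicalAddGroup F] [ContinuousSMul ℝ F] [LocallyConvexSpace ℝ F]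
    [IsTopologicalAddGroup H] [ContinuousSMul ℝ H] [LocallyConvexSpace ℝ H]
    {f : E → F} {g : F → H} {dg : F × F → H} {V : Set F} (hV : IsOpen V) {x v : E} {w : F}
    (hx : f x ∈ V)
    (hf : Tendsto (fun h : ℝ => h⁻¹ • (f (x + h • v) - f x)) (𝓝[≠] 0) (𝓝 w))
    (hd : ∀ y ∈ V, ∀ z : F, Tendsto (fun h : ℝ => h⁻¹ • (g (y + h • z) - g y)) (𝓝[≠] 0)
      (𝓝 (dg (y, z))))
    (hdg : ContinuousOn dg (V ×ˢ univ)) :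
    Tendsto (fun h : ℝ => h⁻¹ • (g (f (x + h • v)) - g (f x))) (𝓝[≠] 0) (𝓝 (dg (f x, w))) := by
  intro O hO
  obtain ⟨C, hC, hCc, hCcl, hCO⟩ := exists_closed_convex_nhds hO
  have hcont : ContinuousAt dg (f x, w) :=
    hdg.continuousAt ((hV.prod isOpen_univ).mem_nhds ⟨hx, mem_univ _⟩)
  obtain ⟨A₀, hA₀, B, hB, hAB⟩ := mem_nhds_prod_iff.1 (hcont hC)
  obtain ⟨A, ⟨hA, hAc⟩, hAs⟩ := (LocallyConvexSpace.convex_basis (𝕜 := ℝ) (f x)).mem_iff.1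
    (inter_mem hA₀ (hV.mem_nhds hx))
  set W : ℝ → F := fun h => h⁻¹ • (f (x + h • v) - f x) with hW
  have hfA : ∀ᶠ h : ℝ in 𝓝[≠] 0, f x + h • W h ∈ A := by
    have h1 : Tendsto (fun h : ℝ => h) (𝓝[≠] 0) (𝓝 0) := nhdsWithin_le_nhds
    have h2 : Tendsto (fun h : ℝ => f x + h • W h) (𝓝[≠] 0) (𝓝 (f x + (0 : ℝ) • w)) :=
      tendsto_const_nhds.add (h1.smul hf)
    rw [zero_smul, add_zero] at h2
    exact h2 hA
  change ∀ᶠ h : ℝ in 𝓝[≠] 0, h⁻¹ • (g (f (x + h • v)) - g (f x)) ∈ O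
  filter_upwards [hfA, hf hB, self_mem_nhdsWithin] with h hhA hhB hh0
  replace hhB : W h ∈ B := hhB
  replace hh0 : h ≠ 0 := hh0
  apply hCO
  have hend : f (x + h • v) = f x + h • W h := by
    simp only [hW, smul_inv_smul₀ hh0]; abel
  -- the curve that runs along the segment from `f x` to `f (x + h • v)`
  have hseg : ∀ s ∈ Icc (0 : ℝ) 1, f x + (s * h) • W h ∈ A := by
    intro s hs
    have := hAc.add_smul_sub_mem (mem_of_mem_nhds hA) hhA hs
    simpa [smul_smul] using this
  have key := sub_mem_of_velocity_mem (γ := fun s => h⁻¹ • g (f x + (s * h) • W h))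
    (γ' := fun s => dg (f x + (s * h) • W h, W h)) hCc hCcl ?_ ?_
  · simpa [hend, smul_sub] using key
  · intro s hs
    have h1 := hd _ (hAs (hseg s hs)).2 (W h)
    have h2 : Tendsto (fun t : ℝ => t * h) (𝓝[≠] 0) (𝓝[≠] 0) := by
      refine tendsto_nhdsWithin_iff.2 ⟨?_, ?_⟩
      · have : Tendsto (fun t : ℝ => t * h) (𝓝 0) (𝓝 (0 * h)) := Continuous.tendsto (by fun_prop) 0
        rw [zero_mul] at this
        exact this.mono_left nhdsWithin_le_nhds
      · filter_upwards [self_mem_nhdsWithin] with t ht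
        exact mul_ne_zero ht hh0
    refine (h1.comp h2).congr fun t => ?_
    simp only [Function.comp_apply, mul_inv, ← smul_sub, smul_smul, add_mul, add_smul, add_assoc]
  · intro s hs
    exact hAB (mk_mem_prod (hAs (hseg s hs)).1 hhB)

theorem BContDiffOn.comp {n : ℕ} : ∀ {E F H : Type u} [AddCommGroup E] [Module ℝ E]
    [TopologicalSpace E] [ContinuousAdd E] [ContinuousSMul ℝ E]
    [AddCommGroup F] [Module ℝ F] [TopologicalSpace F]
    [IsTopologicalAddGroup F] [ContinuousSMul ℝ F] [LocallyConvexSpace ℝ F]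
    [AddCommGroup H] [Module ℝ H] [TopologicalSpace H]
    [IsTopologicalAddGroup H] [ContinuousSMul ℝ H] [LocallyConvexSpace ℝ H]
    {f : E → F} {g : F → H} {U : Set E} {V : Set F}, IsOpen V →
    BContDiffOn n g V → BContDiffOn n f U → MapsTo f U V →
    BContDiffOn n (fun x => g (f x)) U := by
  induction n with
  | zero => intros; exact ContinuousOn.comp ‹_› ‹_› ‹_›
  | succ n ih =>
    intro E F H _ _ _ _ _ _ _ _ _ _ _ _ _ _ _ _ _ f g U V hV hg hf hUV
    have hf' := hf.of_succ
    obtain ⟨hgc, dg, hgd, hgn⟩ := hg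
    obtain ⟨hfc, df, hfd, hfn⟩ := hf
    refine ⟨hgc.comp hfc hUV, fun p => dg (f p.1, df p), fun x hx v =>
      tendsto_comp_slope hV (hUV hx) (hfd x hx v) hgd hgn.continuousOn, ?_⟩
    have h1 : BContDiffOn n (fun p : E × E => f p.1) (U ×ˢ univ) := by
      have h := BContDiffOn.prod_comp n (ContinuousLinearMap.fst ℝ E E)
        (ContinuousLinearMap.fst ℝ E E) hf' hf'
      have h2 := ih isOpen_univ
        ((ContinuousLinearMap.fst ℝ F F).bContDiffOn univ) h (mapsTo_univ _ _)
      refine h2.mono ?_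
      rintro p ⟨hp, -⟩
      exact ⟨hp, hp⟩
    exact ih (f := fun p => (f p.1, df p)) (hV.prod isOpen_univ) hgn (h1.prodMk hfn)
      fun p hp => ⟨hUV hp.1, mem_univ _⟩

end Calculus

/-! ### Smooth maps between manifolds -/

namespace LCManifold

variable {M N P : Type u} {S : LCManifold M} {T : LCManifold N} {R : LCManifold P}

theorem Open.inter {U V : Set M} (hU : S.Open U) (hV : S.Open V) : S.Open (U ∩ V) :=
  let := S.top
  IsOpen.inter (X := M) hU hV

theorem Open.prod {U : Set M} {V : Set N} (hU : S.Open U) (hV : T.Open V) :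
    (S.prod T).Open (U ×ˢ V) :=
  let := S.top
  let := T.top
  IsOpen.prod (X := M) (Y := N) hU hV

theorem open_univ (S : LCManifold M) : S.Open univ :=
  let := S.top
  isOpen_univ (X := M)

theorem SmoothOn.mono {f : M → N} {U V : Set M} (hf : S.SmoothOn T f U) (h : V ⊆ U) :
    S.SmoothOn T f V := by
  let := S.top
  let := T.top
  refine ⟨hf.1.mono h, fun e he e' he' n => (hf.2 e he e' he' n).mono ?_⟩
  exact inter_subset_inter_right _ (preimage_mono (inter_subset_inter_left _ h))

theorem SmoothOn.open_inter_preimage {f : M → N} {U : Set M} {V : Set N}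
    (hf : S.SmoothOn T f U) (hU : S.Open U) (hV : T.Open V) : S.Open (U ∩ f ⁻¹' V) := by
  let := S.top
  let := T.top
  exact hf.1.isOpen_inter_preimage hU hV

theorem SmoothOn.of_locally {f : M → N} {U : Set M}
    (h : ∀ x ∈ U, ∃ V, S.Open V ∧ x ∈ V ∧ S.SmoothOn T f V) : S.SmoothOn T f U := by
  let := S.top
  let := T.top
  refine ⟨fun x hx => ?_, fun e he e' he' n => BContDiffOn.of_locally fun y hy => ?_⟩
  · obtain ⟨V, hV, hxV, hf⟩ := h x hx
    exact (hf.1.continuousAt (IsOpen.mem_nhds hV hxV)).continuousWithinAt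
  · obtain ⟨V, hV, hxV, hf⟩ := h _ hy.2.1
    exact ⟨_, e.isOpen_inter_preimage_symm (hf.1.isOpen_inter_preimage hV e'.open_source),
      ⟨hy.1, hxV, hy.2.2⟩, hf.2 e he e' he' n⟩

theorem SmoothOn.congr {f g : M → N} {U : Set M} (hU : S.Open U) (hf : S.SmoothOn T f U)
    (hfg : EqOn g f U) : S.SmoothOn T g U := by
  let := S.top
  let := T.top
  refine ⟨hf.1.congr hfg, fun e he e' he' n => ?_⟩
  have hset : e.target ∩ e.symm ⁻¹' (U ∩ g ⁻¹' e'.source) =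
      e.target ∩ e.symm ⁻¹' (U ∩ f ⁻¹' e'.source) := by
    ext y
    simp only [mem_inter_iff, mem_preimage, and_congr_right_iff]
    intro _ hy
    rw [hfg hy]
  rw [hset]
  refine (hf.2 e he e' he' n).congr
    (e.isOpen_inter_preimage_symm (hf.1.isOpen_inter_preimage hU e'.open_source)) ?_
  intro y hy
  simp only [hfg hy.2.1]

theorem SmoothOn.comp {f : M → N} {g : N → P} {U : Set M} {V : Set N} (hg : T.SmoothOn R g V)
    (hf : S.SmoothOn T f U) (hU : S.Open U) (hV : T.Open V) (h : MapsTo f U V) :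
    S.SmoothOn R (fun x => g (f x)) U := by
  let := S.top
  let := T.top
  let := R.top
  refine ⟨hg.1.comp hf.1 h, fun e he e'' he'' n => BContDiffOn.of_locally fun y hy => ?_⟩
  obtain ⟨e', he', hy'⟩ := T.exists_chart (f (e.symm y))
  have hO : IsOpen (e'.source ∩ (V ∩ g ⁻¹' e''.source)) :=
    e'.open_source.inter (hg.1.isOpen_inter_preimage hV e''.open_source)
  have hD := e.isOpen_inter_preimage_symm (hf.1.isOpen_inter_preimage hU hO)
  refine ⟨_, hD, ⟨hy.1, hy.2.1, hy', h hy.2.1, hy.2.2⟩, ?_⟩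
  have h1 := (hf.2 e he e' he' n).mono
    (V := e.target ∩ e.symm ⁻¹' (U ∩ f ⁻¹' (e'.source ∩ (V ∩ g ⁻¹' e''.source))))
    (fun z hz => ⟨hz.1, hz.2.1, hz.2.2.1⟩)
  have h2 := BContDiffOn.comp
    (e'.isOpen_inter_preimage_symm (hg.1.isOpen_inter_preimage hV e''.open_source))
    (hg.2 e' he' e'' he'' n) h1 ?_
  · refine h2.congr hD fun z hz => ?_
    simp only [e'.left_inv hz.2.2.1]
  · intro z hz
    refine ⟨e'.map_source hz.2.2.1, ?_⟩
    rw [mem_preimage, e'.left_inv hz.2.2.1]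
    exact hz.2.2.2

theorem SmoothOn.id (S : LCManifold M) (U : Set M) : S.SmoothOn S (fun x => x) U := by
  let := S.top
  exact ⟨continuousOn_id, fun e he e' he' n => (S.compatible e he e' he' n).mono
    fun y hy => ⟨hy.1, hy.2.2⟩⟩

theorem SmoothOn.const (S : LCManifold M) (T : LCManifold N) (c : N) (U : Set M) :
    S.SmoothOn T (fun _ => c) U := by
  let := S.top
  let := T.top
  exact ⟨continuousOn_const, fun e he e' he' n => BContDiffOn.const _ _⟩

theorem smooth_fst (S : LCManifold M) (T : LCManifold N) : (S.prod T).Smooth S Prod.fst := by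
  let := S.top
  let := T.top
  refine ⟨continuous_fst.continuousOn, ?_⟩
  rintro _ ⟨e₁, he₁, e₂, he₂, rfl⟩ e' he' n
  exact (BContDiffOn.comp (f := Prod.fst)
    (U := Prod.fst ⁻¹' (e₁.target ∩ e₁.symm ⁻¹' e'.source))
    (e₁.isOpen_inter_preimage_symm e'.open_source) (S.compatible e₁ he₁ e' he' n)
    ((ContinuousLinearMap.fst ℝ S.Model T.Model).bContDiffOn _) fun y hy => hy).mono
    fun y hy => ⟨hy.1.1, hy.2.2⟩

theorem smooth_snd (S : LCManifold M) (T : LCManifold N) : (S.prod T).Smooth T Prod.snd := by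
  let := S.top
  let := T.top
  refine ⟨continuous_snd.continuousOn, ?_⟩
  rintro _ ⟨e₁, he₁, e₂, he₂, rfl⟩ e' he' n
  exact (BContDiffOn.comp (f := Prod.snd)
    (U := Prod.snd ⁻¹' (e₂.target ∩ e₂.symm ⁻¹' e'.source))
    (e₂.isOpen_inter_preimage_symm e'.open_source) (T.compatible e₂ he₂ e' he' n)
    ((ContinuousLinearMap.snd ℝ S.Model T.Model).bContDiffOn _) fun y hy => hy).mono
    fun y hy => ⟨hy.1.2, hy.2.2⟩

theorem SmoothOn.prodMk {f : M → N} {g : M → P} {U : Set M} (hf : S.SmoothOn T f U)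
    (hg : S.SmoothOn R g U) : S.SmoothOn (T.prod R) (fun x => (f x, g x)) U := by
  let := S.top
  let := T.top
  let := R.top
  refine ⟨hf.1.prodMk hg.1, ?_⟩
  rintro e he _ ⟨e₁, he₁, e₂, he₂, rfl⟩ n
  exact ((hf.2 e he e₁ he₁ n).mono fun y hy => ⟨hy.1, hy.2.1, hy.2.2.1⟩).prodMk
    ((hg.2 e he e₂ he₂ n).mono fun y hy => ⟨hy.1, hy.2.1, hy.2.2.2⟩)

/-! ### Smoothness at a point -/

/-- `f` is smooth on some open neighbourhood of `x`. -/
def SmoothAt (S : LCManifold M) (T : LCManifold N) (f : M → N) (x : M) : Prop :=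
  ∃ U, S.Open U ∧ x ∈ U ∧ S.SmoothOn T f U

theorem SmoothOn.smoothAt {f : M → N} {U : Set M} (hf : S.SmoothOn T f U) (hU : S.Open U) {x : M}
    (hx : x ∈ U) : S.SmoothAt T f x := ⟨U, hU, hx, hf⟩

theorem Smooth.smoothAt {f : M → N} (hf : S.Smooth T f) (x : M) : S.SmoothAt T f x :=
  SmoothOn.smoothAt hf S.open_univ (mem_univ x)

theorem smoothOn_of_smoothAt {f : M → N} {U : Set M} (h : ∀ x ∈ U, S.SmoothAt T f x) :
    S.SmoothOn T f U := SmoothOn.of_locally h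

theorem smooth_of_smoothAt {f : M → N} (h : ∀ x, S.SmoothAt T f x) : S.Smooth T f :=
  smoothOn_of_smoothAt fun x _ => h x

/-- The neighbourhood filter of a point of a manifold. -/
def nhd (S : LCManifold M) (x : M) : Filter M := @nhds M S.top x

theorem mem_nhd {x : M} {A : Set M} : A ∈ S.nhd x ↔ ∃ U ⊆ A, S.Open U ∧ x ∈ U :=
  let := S.top
  mem_nhds_iff (x := x)

theorem Open.mem_nhd {U : Set M} (hU : S.Open U) {x : M} (hx : x ∈ U) : U ∈ S.nhd x :=
  LCManifold.mem_nhd.2 ⟨U, subset_rfl, hU, hx⟩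

theorem nhd_prod (S : LCManifold M) (T : LCManifold N) (x : M) (y : N) :
    (S.prod T).nhd (x, y) = S.nhd x ×ˢ T.nhd y :=
  let := S.top
  let := T.top
  nhds_prod_eq (x := x) (y := y)

theorem self_of_eventually {x : M} {p : M → Prop} (h : ∀ᶠ y in S.nhd x, p y) : p x :=
  let := S.top
  h.self_of_nhds

theorem SmoothAt.tendsto {f : M → N} {x : M} (hf : S.SmoothAt T f x) :
    Tendsto f (S.nhd x) (T.nhd (f x)) := by
  let := S.top
  let := T.top
  obtain ⟨U, hU, hx, hf⟩ := hf
  exact hf.1.continuousAt (IsOpen.mem_nhds hU hx)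

theorem SmoothAt.eventually {f : M → N} {x : M} (hf : S.SmoothAt T f x) :
    ∀ᶠ y in S.nhd x, S.SmoothAt T f y := by
  obtain ⟨U, hU, hx, hf⟩ := hf
  filter_upwards [hU.mem_nhd hx] with y hy using hf.smoothAt hU hy

theorem SmoothAt.congr {f g : M → N} {x : M} (hf : S.SmoothAt T f x)
    (h : ∀ᶠ y in S.nhd x, g y = f y) : S.SmoothAt T g x := by
  obtain ⟨U, hU, hx, hf⟩ := hf
  obtain ⟨V, hV, hVo, hxV⟩ := mem_nhd.1 h
  exact ⟨U ∩ V, hU.inter hVo, ⟨hx, hxV⟩, (hf.mono inter_subset_left).congr (hU.inter hVo)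
    fun y hy => hV hy.2⟩

theorem SmoothAt.comp {f : M → N} {g : N → P} {x : M} (hg : T.SmoothAt R g (f x))
    (hf : S.SmoothAt T f x) : S.SmoothAt R (fun x => g (f x)) x := by
  obtain ⟨U, hU, hx, hf⟩ := hf
  obtain ⟨V, hV, hxV, hg⟩ := hg
  have hUV := hf.open_inter_preimage hU hV
  exact ⟨_, hUV, ⟨hx, hxV⟩, hg.comp (hf.mono inter_subset_left) hUV hV fun y hy => hy.2⟩

theorem SmoothAt.comp_of_eq {f : M → N} {g : N → P} {x : M} {y : N} (hg : T.SmoothAt R g y)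
    (hf : S.SmoothAt T f x) (h : f x = y) : S.SmoothAt R (fun x => g (f x)) x := by
  subst h
  exact hg.comp hf

theorem SmoothAt.id (S : LCManifold M) (x : M) : S.SmoothAt S (fun x => x) x :=
  (SmoothOn.id S univ).smoothAt S.open_univ (mem_univ x)

theorem SmoothAt.const (S : LCManifold M) (T : LCManifold N) (c : N) (x : M) :
    S.SmoothAt T (fun _ => c) x :=
  (SmoothOn.const S T c univ).smoothAt S.open_univ (mem_univ x)

theorem SmoothAt.fst (S : LCManifold M) (T : LCManifold N) (x : M × N) :
    (S.prod T).SmoothAt S (fun p => p.1) x := (smooth_fst S T).smoothAt x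

theorem SmoothAt.snd (S : LCManifold M) (T : LCManifold N) (x : M × N) :
    (S.prod T).SmoothAt T (fun p => p.2) x := (smooth_snd S T).smoothAt x

theorem SmoothAt.prodMk {f : M → N} {g : M → P} {x : M} (hf : S.SmoothAt T f x)
    (hg : S.SmoothAt R g x) : S.SmoothAt (T.prod R) (fun x => (f x, g x)) x := by
  obtain ⟨U, hU, hx, hf⟩ := hf
  obtain ⟨V, hV, hxV, hg⟩ := hg
  exact ⟨U ∩ V, hU.inter hV, ⟨hx, hxV⟩, (hf.mono inter_subset_left).prodMk
    (hg.mono inter_subset_right)⟩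

/-- Composition with a map of two variables. -/
theorem SmoothAt.comp₂ {Q : Type u} {SQ : LCManifold Q} {F : N × P → Q} {f : M → N} {g : M → P}
    {x : M} {y : N} {z : P} (hF : (T.prod R).SmoothAt SQ F (y, z)) (hf : S.SmoothAt T f x)
    (hg : S.SmoothAt R g x) (hy : f x = y) (hz : g x = z) :
    S.SmoothAt SQ (fun x => F (f x, g x)) x :=
  hF.comp_of_eq (hf.prodMk hg) (by rw [hy, hz])

end LCManifold

/-! ### Gluing manifolds -/

namespace LCManifold

variable {X M B : Type u}

/-- A set `X` that is covered by partial bijections `Φ k` onto open subsets of a manifold `M` with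
smooth transition maps is a manifold such that the `Φ k` are diffeomorphisms. The Hausdorff property
comes from a map `p : X → B` to a Hausdorff manifold: points with distinct images are separated by
`p`, and points with the same image are assumed to lie in the domain of a common `Φ k`. -/
theorem exists_glued {K : Type u} (S : LCManifold M) (SB : LCManifold B)
    (Φ : K → PartialEquiv X M) (p : X → B)
    (hopen : ∀ k l, S.Open ((Φ k).target ∩ (Φ k).symm ⁻¹' (Φ l).source))
    (hsm : ∀ k l, S.SmoothOn S (fun y => Φ l ((Φ k).symm y))
      ((Φ k).target ∩ (Φ k).symm ⁻¹' (Φ l).source))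
    (hp : ∀ k, S.SmoothOn SB (fun y => p ((Φ k).symm y)) (Φ k).target)
    (hcov : ∀ x y, p x = p y → ∃ k, x ∈ (Φ k).source ∧ y ∈ (Φ k).source) :
    ∃ T : LCManifold X, ∀ k, T.Open (Φ k).source ∧ T.SmoothOn S (Φ k) (Φ k).source ∧
      S.SmoothOn T (Φ k).symm (Φ k).target := by
  let := S.top
  let := SB.top
  have := SB.t2
  choose ch hch using fun x => hcov x x rfl
  let core : ChartedSpaceCore M X :=
    { atlas := range Φ
      chartAt := fun x => Φ (ch x)
      mem_chart_source := fun x => (hch x).1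
      chart_mem_atlas := fun x => mem_range_self _
      open_source := by
        rintro _ _ ⟨k, rfl⟩ ⟨l, rfl⟩
        exact hopen k l
      continuousOn_toFun := by
        rintro _ _ ⟨k, rfl⟩ ⟨l, rfl⟩
        exact (hsm k l).1 }
  let : TopologicalSpace X := core.toTopologicalSpace
  let Ψ : K → OpenPartialHomeomorph X M := fun k =>
    core.openPartialHomeomorph (Φ k) (mem_range_self k)
  have hpc : Continuous p := by
    rw [continuous_iff_continuousAt]
    intro x
    have h1 : ContinuousAt (Ψ (ch x)) x := (Ψ (ch x)).continuousAt (hch x).1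
    have h2 : ContinuousAt (fun y => p ((Φ (ch x)).symm y)) (Ψ (ch x) x) :=
      (hp (ch x)).1.continuousAt ((Ψ (ch x)).open_target.mem_nhds ((Ψ (ch x)).map_source (hch x).1))
    refine (h2.comp h1).congr ?_
    filter_upwards [(Ψ (ch x)).open_source.mem_nhds (hch x).1] with y hy
    exact congrArg p ((Φ (ch x)).left_inv hy)
  have hT2 : T2Space X := by
    refine ⟨fun x y hxy => ?_⟩
    by_cases h : p x = p y
    · obtain ⟨k, hx, hy⟩ := hcov x y h
      have := S.t2
      obtain ⟨U, V, hU, hV, hxU, hyV, hUV⟩ := t2_separation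
        (fun h => hxy ((Ψ k).injOn hx hy h) : Ψ k x ≠ Ψ k y)
      refine ⟨_, _, (Ψ k).isOpen_inter_preimage hU, (Ψ k).isOpen_inter_preimage hV,
        ⟨hx, hxU⟩, ⟨hy, hyV⟩, ?_⟩
      exact (hUV.preimage (Ψ k)).mono inter_subset_right inter_subset_right
    · obtain ⟨U, V, hU, hV, hxU, hyV, hUV⟩ := t2_separation h
      exact ⟨_, _, hU.preimage hpc, hV.preimage hpc, hxU, hyV, hUV.preimage p⟩
  let T : LCManifold X :=
    { Model := S.Model
      charts := {c | ∃ k, ∃ e ∈ S.charts, c = (Ψ k).trans e}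
      exists_chart := by
        intro x
        obtain ⟨e, he, hx⟩ := S.exists_chart (Ψ (ch x) x)
        exact ⟨_, ⟨ch x, e, he, rfl⟩, (hch x).1, hx⟩
      compatible := by
        rintro _ ⟨k, e, he, rfl⟩ _ ⟨l, e', he', rfl⟩ n
        refine ((hsm k l).2 e he e' he' n).mono ?_
        rintro y ⟨⟨h1, h2⟩, h3, h4⟩
        exact ⟨h1, ⟨h2, h3⟩, h4⟩ }
  refine ⟨T, fun k => ⟨(Ψ k).open_source, ⟨(Ψ k).continuousOn, ?_⟩, ⟨(Ψ k).continuousOn_symm, ?_⟩⟩⟩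
  · rintro _ ⟨l, e, he, rfl⟩ e' he' n
    refine ((hsm l k).2 e he e' he' n).mono ?_
    rintro y ⟨⟨h1, h2⟩, h3, h4⟩
    exact ⟨h1, ⟨h2, h3⟩, h4⟩
  · rintro e he _ ⟨l, e', he', rfl⟩ n
    refine ((hsm k l).2 e he e' he' n).mono ?_
    rintro y ⟨h1, h2, h3, h4⟩
    exact ⟨h1, ⟨h2, h3⟩, h4⟩

/-- Transport of a manifold structure along a bijection. -/
theorem exists_transported (S : LCManifold M) (φ : X ≃ M) :
    ∃ T : LCManifold X, T.Smooth S φ ∧ S.Smooth T φ.symm := by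
  obtain ⟨T, hT⟩ := exists_glued (K := PUnit) S S (fun _ => φ.toPartialEquiv) φ
    (fun _ _ => by simpa using S.open_univ) (fun _ _ => by simpa using SmoothOn.id S _)
    (fun _ => by simpa using SmoothOn.id S _) (fun _ _ _ => ⟨⟨⟩, trivial, trivial⟩)
  exact ⟨T, (hT ⟨⟩).2⟩

end LCManifold

/-! ### Lie groups -/

namespace LCManifold

variable {X H : Type u} {S : LCManifold X} {T : LCManifold H}

section LieGroup

variable [Group H]

theorem IsLieGroup.smoothAt_mul (hT : T.IsLieGroup) {f g : X → H} {x : X} (hf : S.SmoothAt T f x)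
    (hg : S.SmoothAt T g x) : S.SmoothAt T (fun x => f x * g x) x :=
  (hT.1.smoothAt (f x, g x)).comp₂ hf hg rfl rfl

theorem IsLieGroup.smoothAt_inv (hT : T.IsLieGroup) {f : X → H} {x : X}
    (hf : S.SmoothAt T f x) : S.SmoothAt T (fun x => (f x)⁻¹) x :=
  (hT.2.smoothAt (f x)).comp hf

theorem IsLieGroup.isTopologicalGroup (hT : T.IsLieGroup) :
    @IsTopologicalGroup H T.top _ := by
  let := T.top
  exact { continuous_mul := continuousOn_univ.1 hT.1.1
          continuous_inv := continuousOn_univ.1 hT.2.1 }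

/-- A connected Lie group has no proper subgroup that is a neighbourhood of the unit. -/
theorem IsLieGroup.eq_top_of_mem_nhd (hT : T.IsLieGroup) (hconn : @ConnectedSpace H T.top)
    {K : Subgroup H} (hK : (K : Set H) ∈ T.nhd 1) : K = ⊤ := by
  let := T.top
  have := hT.isTopologicalGroup
  have hopen : IsOpen (K : Set H) := K.isOpen_of_mem_nhds hK
  have hclopen : IsClopen (K : Set H) := ⟨K.isClosed_of_isOpen hopen, hopen⟩
  exact SetLike.coe_injective (hclopen.eq_univ ⟨1, K.one_mem⟩)

/-- A manifold structure on a group is a Lie group structure if left translations are smooth and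
if multiplication, inversion and all conjugations are smooth near the unit. -/
theorem isLieGroup_of_smoothAt_one (hL : ∀ a x, T.SmoothAt T (fun y => a * y) x)
    (hm : (T.prod T).SmoothAt T (fun p => p.1 * p.2) (1, 1))
    (hi : T.SmoothAt T (fun x => x⁻¹) 1)
    (hc : ∀ c, T.SmoothAt T (fun x => c * x * c⁻¹) 1) : T.IsLieGroup := by
  constructor
  · refine smooth_of_smoothAt ?_
    rintro ⟨a, b⟩
    have h1 : (T.prod T).SmoothAt T (fun p : H × H => a⁻¹ * p.1) (a, b) :=
      (hL _ _).comp (SmoothAt.fst T T _)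
    have h2 : (T.prod T).SmoothAt T (fun p : H × H => b⁻¹ * p.2) (a, b) :=
      (hL _ _).comp (SmoothAt.snd T T _)
    have h3 := (hc b⁻¹).comp_of_eq h1 (by simp)
    -- `x * y = (a * b) * ((b⁻¹ * (a⁻¹ * x) * b) * (b⁻¹ * y))`
    have h4 := (hL (a * b) _).comp (hm.comp₂ h3 h2 (by simp) (by simp))
    refine h4.congr (Eventually.of_forall fun p => ?_)
    group
  · refine smooth_of_smoothAt fun a => ?_
    have h1 := (hi.comp_of_eq (hL a⁻¹ a) (by simp))
    -- `x⁻¹ = a⁻¹ * (a * (a⁻¹ * x)⁻¹ * a⁻¹)`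
    have h2 := (hL a⁻¹ _).comp ((hc a).comp_of_eq h1 (by simp))
    refine h2.congr (Eventually.of_forall fun x => ?_)
    group

/-- A homomorphism of Lie groups that is smooth near the unit is smooth. -/
theorem IsLieGroup.smooth_of_smoothAt_one {H' : Type u} [Group H'] {T' : LCManifold H'}
    (hT : T.IsLieGroup) (hT' : T'.IsLieGroup) (f : H →* H') (hf : T.SmoothAt T' f 1) :
    T.Smooth T' f := by
  refine smooth_of_smoothAt fun a => ?_
  have h1 := hf.comp_of_eq (hT.smoothAt_mul (SmoothAt.const T T a⁻¹ a) (SmoothAt.id T a))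
    (by simp)
  refine (hT'.smoothAt_mul (SmoothAt.const T T' (f a) a) h1).congr
    (Eventually.of_forall fun x => ?_)
  simp

/-- A quotient of a Lie group is a Lie group if the projection has local smooth sections. -/
theorem IsLieGroup.of_sections {Q : Type u} [Group Q] {SQ : LCManifold Q} (hT : T.IsLieGroup)
    (π : H →* Q) (hπ : T.Smooth SQ π)
    (hs : ∀ b, ∃ σ : Q → H, SQ.SmoothAt T σ b ∧ ∀ᶠ w in SQ.nhd b, π (σ w) = w) :
    SQ.IsLieGroup := by
  constructor
  · refine smooth_of_smoothAt ?_
    rintro ⟨a, b⟩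
    obtain ⟨σ, hσ, hσ'⟩ := hs a
    obtain ⟨ρ, hρ, hρ'⟩ := hs b
    have h := (hπ.smoothAt _).comp (hT.smoothAt_mul
      (hσ.comp_of_eq (SmoothAt.fst SQ SQ (a, b)) rfl)
      (hρ.comp_of_eq (SmoothAt.snd SQ SQ (a, b)) rfl))
    refine h.congr ?_
    filter_upwards [(SmoothAt.fst SQ SQ (a, b)).tendsto.eventually hσ',
      (SmoothAt.snd SQ SQ (a, b)).tendsto.eventually hρ'] with p h1 h2
    rw [map_mul, h1, h2]
  · refine smooth_of_smoothAt fun b => ?_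
    obtain ⟨ρ, hρ, hρ'⟩ := hs b
    refine ((hπ.smoothAt _).comp (hT.smoothAt_inv hρ)).congr ?_
    filter_upwards [hρ'] with x hx
    rw [map_inv, hx]

end LieGroup

end LCManifold

/-! ### Central extensions of abstract groups with a section -/

/-- A central extension `N → H → G` of abstract groups with a set-theoretic section `σ` of the
projection that preserves the unit, and with the resulting coordinate `κ : H → N`, so that
`x ↦ (p x, κ x)` is a bijection `H ≃ G × N`. -/
structure SectionedExtension (N H G : Type u) [Group N] [Group H] [Group G] where
  i : N →* H
  p : H →* G
  σ : G → H
  κ : H → N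
  injective : Function.Injective i
  central : ∀ n x, i n * x = x * i n
  p_i : ∀ n, p (i n) = 1
  p_σ : ∀ g, p (σ g) = g
  σ_one : σ 1 = 1
  σ_mul_i : ∀ x, σ (p x) * i (κ x) = x

namespace SectionedExtension

variable {N H G : Type u} [Group N] [Group H] [Group G] (E : SectionedExtension N H G)

/-- The cocycle `c` of the section: `σ g * σ h = σ (g * h) * i (c g h)`. -/
def cocycle (g h : G) : N := E.κ (E.σ g * E.σ h)

theorem κ_mul_i (x : H) (n : N) : E.κ (x * E.i n) = E.κ x * n := by
  apply E.injective
  have h1 := E.σ_mul_i (x * E.i n)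
  have h2 := E.σ_mul_i x
  rw [map_mul, E.p_i, mul_one] at h1
  have h3 : E.σ (E.p x) * E.i (E.κ (x * E.i n)) = E.σ (E.p x) * (E.i (E.κ x) * E.i n) := by
    rw [h1, ← mul_assoc, h2]
  rw [mul_left_cancel h3, map_mul]

theorem κ_σ (g : G) : E.κ (E.σ g) = 1 := by
  apply E.injective
  have h := E.σ_mul_i (E.σ g)
  rw [E.p_σ] at h
  simpa using h

theorem κ_i (n : N) : E.κ (E.i n) = n := by
  have := E.κ_mul_i (E.σ 1) n
  rwa [E.κ_σ, E.σ_one, one_mul, one_mul] at this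

theorem σ_mul_σ (g h : G) : E.σ g * E.σ h = E.σ (g * h) * E.i (E.cocycle g h) := by
  have := E.σ_mul_i (E.σ g * E.σ h)
  rw [map_mul, E.p_σ, E.p_σ] at this
  exact this.symm

theorem coord_mul (g g' : G) (n n' : N) : E.σ g * E.i n * (E.σ g' * E.i n') =
    E.σ (g * g') * E.i (E.cocycle g g' * n * n') := by
  rw [mul_assoc, ← mul_assoc (E.i n), E.central n, mul_assoc, ← mul_assoc (E.σ g), σ_mul_σ]
  simp [mul_assoc]

theorem coord_inv (g : G) (n : N) : (E.σ g * E.i n)⁻¹ =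
    E.σ g⁻¹ * E.i ((E.cocycle g g⁻¹ * n)⁻¹) := by
  rw [inv_eq_iff_mul_eq_one, coord_mul]
  simp [E.σ_one]

theorem conj_coord (w g : G) (n : N) : E.σ w * (E.σ g * E.i n) * (E.σ w)⁻¹ =
    E.σ (w * g * w⁻¹) * E.i ((E.cocycle (w * g * w⁻¹) w)⁻¹ * E.cocycle w g * n) := by
  rw [mul_inv_eq_iff_eq_mul, mul_assoc (E.σ (w * g * w⁻¹)), E.central, ← mul_assoc, ← mul_assoc,
    σ_mul_σ, σ_mul_σ]
  simp [mul_assoc]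

/-- The fibre coordinate of a translate of `σ w`, in terms of that of `σ w₀`. If `w` is near `w₀`,
then the cocycle is evaluated near `(p k * w₀, 1)` and `(w₀, 1)` only. -/
theorem κ_mul_σ (k : H) (w₀ w : G) : E.κ (k * E.σ w) =
    E.cocycle (E.p k * w₀) (w₀⁻¹ * w) * E.κ (k * E.σ w₀) * (E.cocycle w₀ (w₀⁻¹ * w))⁻¹ := by
  have h1 := E.σ_mul_σ w₀ (w₀⁻¹ * w)
  rw [mul_inv_cancel_left] at h1
  have h2 := E.σ_mul_i (k * E.σ w₀)
  rw [map_mul, E.p_σ] at h2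
  obtain ⟨m, hm⟩ : ∃ m, E.κ (k * E.σ w₀) = m := ⟨_, rfl⟩
  rw [hm] at h2 ⊢
  have h3 : k * E.σ w = E.σ (E.p k * w) * E.i (E.cocycle (E.p k * w₀) (w₀⁻¹ * w) * m *
      (E.cocycle w₀ (w₀⁻¹ * w))⁻¹) := by
    rw [eq_mul_inv_of_mul_eq h1.symm, ← mul_assoc, ← mul_assoc, ← h2]
    have h4 := E.coord_mul (E.p k * w₀) (w₀⁻¹ * w) m 1
    rw [map_one, mul_one, mul_one] at h4
    rw [h4]
    simp [mul_assoc]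
  rw [h3, κ_mul_i, κ_σ, one_mul]

/-- The coordinates `x ↦ (p x, κ x)` as a bijection. -/
def coordEquiv : H ≃ G × N where
  toFun x := (E.p x, E.κ x)
  invFun y := E.σ y.1 * E.i y.2
  left_inv x := E.σ_mul_i x
  right_inv y := by
    simp [E.p_σ, E.p_i, κ_mul_i, κ_σ]

end SectionedExtension

/-! ### Lie group structures on central extensions -/

namespace SectionedExtension

open LCManifold

variable {N H G : Type u} [Group N] [Group H] [Group G] (E : SectionedExtension N H G)
  {SN : LCManifold N} {SG : LCManifold G}

/-- The coordinate bijection, translated by `h` and restricted to the part over `W`. -/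
def chart (W : Set G) (h : H) : PartialEquiv H (G × N) :=
  ((Equiv.mulLeft h⁻¹).trans E.coordEquiv).toPartialEquiv.restr ((fun x => E.p (h⁻¹ * x)) ⁻¹' W)

/-- A manifold structure on the middle group of a central extension is adapted to a unit
neighbourhood `W` if left translations and the projection are smooth and the coordinates are
diffeomorphisms between the part over `W` and `W × N`. -/
structure IsAdapted (SN : LCManifold N) (SG : LCManifold G) (W : Set G) (T : LCManifold H) :
    Prop where
  smooth_p : T.Smooth SG E.p
  smoothAt_κ : ∀ x, E.p x ∈ W → T.SmoothAt SN E.κ x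
  smoothAt_coord : ∀ g n, g ∈ W → (SG.prod SN).SmoothAt T (fun y => E.σ y.1 * E.i y.2) (g, n)
  smooth_left : ∀ a, T.Smooth T (fun x => a * x)

variable {W : Set G}

theorem chart_source (h : H) : (E.chart W h).source = {x | E.p (h⁻¹ * x) ∈ W} := by
  ext x
  simp [chart]

theorem chart_target (h : H) : (E.chart W h).target = W ×ˢ univ := by
  ext y
  simp [chart, coordEquiv, E.p_σ, E.p_i]

theorem chart_apply (h x : H) : E.chart W h x = (E.p (h⁻¹ * x), E.κ (h⁻¹ * x)) := rfl

theorem chart_symm_apply (h : H) (y : G × N) :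
    (E.chart W h).symm y = h * (E.σ y.1 * E.i y.2) := by
  simp [chart, coordEquiv]

/-- If the cocycle is smooth on `W × W`, then the translated coordinates have smooth transition
maps and define a manifold structure on the middle group. -/
theorem exists_isAdapted (hSG : SG.IsLieGroup) (hSN : SN.IsLieGroup) (hW : SG.Open W)
    (h1W : 1 ∈ W) (hc : ∀ a ∈ W, ∀ b ∈ W,
      (SG.prod SG).SmoothAt SN (fun y => E.cocycle y.1 y.2) (a, b)) :
    ∃ T : LCManifold H, E.IsAdapted SN SG W T := by
  have hdom : ∀ k l : H, (E.chart W k).target ∩ (E.chart W k).symm ⁻¹' (E.chart W l).source =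
      (W ∩ (fun w => E.p (l⁻¹ * k) * w) ⁻¹' W) ×ˢ univ := by
    intro k l
    ext y
    simp [chart_target, chart_source, chart_symm_apply, E.p_σ, E.p_i, mul_assoc]
  have hmul : ∀ (a : G) (x : G), SG.SmoothAt SG (fun w => a * w) x := fun a x =>
    hSG.smoothAt_mul (SmoothAt.const SG SG a x) (SmoothAt.id SG x)
  obtain ⟨T, hT⟩ : ∃ T : LCManifold H, ∀ k, T.Open (E.chart W k).source ∧
      T.SmoothOn (SG.prod SN) (E.chart W k) (E.chart W k).source ∧
      (SG.prod SN).SmoothOn T (E.chart W k).symm (E.chart W k).target := by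
    refine exists_glued (SG.prod SN) SG (E.chart W) E.p ?_ ?_ ?_ ?_
    · intro k l
      rw [hdom]
      exact ((smoothOn_of_smoothAt fun x _ => hmul _ x).open_inter_preimage hW hW).prod SN.open_univ
    · intro k l
      rw [hdom]
      refine smoothOn_of_smoothAt ?_
      rintro ⟨w₀, n₀⟩ ⟨⟨hw₀, hw₁⟩, -⟩
      have hfst := SmoothAt.fst SG SN (w₀, n₀)
      have hsnd := SmoothAt.snd SG SN (w₀, n₀)
      -- near `w₀`, the formula `κ_mul_σ` evaluates the cocycle near points of `W × {1}`
      have hv := (hmul w₀⁻¹ _).comp hfst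
      have hf : ∀ a ∈ W, (SG.prod SN).SmoothAt SN
          (fun y => E.cocycle a (w₀⁻¹ * y.1)) (w₀, n₀) := fun a ha =>
        (hc a ha 1 h1W).comp₂ (SmoothAt.const _ SG a _) hv rfl (by simp)
      have h1 := hSN.smoothAt_mul (hSN.smoothAt_mul (hSN.smoothAt_mul (hf _ hw₁)
        (SmoothAt.const _ SN (E.κ (l⁻¹ * k * E.σ w₀)) _)) (hSN.smoothAt_inv (hf _ hw₀))) hsnd
      refine (((hmul (E.p (l⁻¹ * k)) _).comp hfst).prodMk h1).congr
        (Eventually.of_forall fun y => ?_)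
      simp only [chart_apply, chart_symm_apply, ← E.κ_mul_σ, ← E.κ_mul_i]
      simp [E.p_σ, E.p_i, mul_assoc]
    · intro k
      rw [chart_target]
      refine smoothOn_of_smoothAt ?_
      rintro y -
      refine ((hmul (E.p k) _).comp (SmoothAt.fst SG SN y)).congr (Eventually.of_forall fun y => ?_)
      simp [chart_symm_apply, E.p_σ, E.p_i]
    · intro x y hxy
      refine ⟨x, ?_, ?_⟩ <;> simp [chart_source, ← hxy, h1W]
  have hsymm : ∀ h g n, g ∈ W →
      (SG.prod SN).SmoothAt T (fun y => h * (E.σ y.1 * E.i y.2)) (g, n) := by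
    intro h g n hg
    have h1 := (hT h).2.2
    rw [chart_target] at h1
    refine (h1.smoothAt (hW.prod SN.open_univ) ⟨hg, mem_univ n⟩).congr
      (Eventually.of_forall fun y => ?_)
    rw [chart_symm_apply]
  have hto : ∀ h x, E.p (h⁻¹ * x) ∈ W →
      T.SmoothAt (SG.prod SN) (fun x => (E.p (h⁻¹ * x), E.κ (h⁻¹ * x))) x := by
    intro h x hx
    have h1 := (hT h).2.1
    have h2 := (hT h).1
    rw [chart_source] at h1 h2
    exact h1.smoothAt h2 hx
  refine ⟨T, smooth_of_smoothAt fun x => ?_, fun x hx => ?_, fun g n hg => ?_,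
    fun a => smooth_of_smoothAt fun x => ?_⟩
  · have h1 := (SmoothAt.fst SG SN _).comp (hto x x (by simpa using h1W))
    refine ((hmul (E.p x) _).comp h1).congr (Eventually.of_forall fun y => ?_)
    simp
  · have h1 := (SmoothAt.snd SG SN _).comp (hto 1 x (by simpa using hx))
    simpa using h1
  · simpa using hsymm 1 g n hg
  · have h1 := (hsymm (a * x) (E.p (x⁻¹ * x)) (E.κ (x⁻¹ * x)) (by simpa using h1W)).comp_of_eq
      (hto x x (by simpa using h1W)) rfl
    refine h1.congr (Eventually.of_forall fun y => ?_)
    simp only [E.σ_mul_i]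
    group

theorem exists_open_smoothAt_cocycle
    (hc : (SG.prod SG).SmoothAt SN (fun y => E.cocycle y.1 y.2) (1, 1)) :
    ∃ W, SG.Open W ∧ 1 ∈ W ∧ ∀ a ∈ W, ∀ b ∈ W,
      (SG.prod SG).SmoothAt SN (fun y => E.cocycle y.1 y.2) (a, b) := by
  have h := hc.eventually
  rw [nhd_prod] at h
  obtain ⟨A, hA, hA'⟩ := mem_prod_same_iff.1 h
  obtain ⟨W, hWA, hW, h1⟩ := mem_nhd.1 hA
  exact ⟨W, hW, h1, fun a ha b hb => hA' ⟨hWA ha, hWA hb⟩⟩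

variable {E} {T : LCManifold H}

namespace IsAdapted

/-- A map into the middle group is smooth near a point over `W` if its coordinates are. -/
theorem smoothAt_of_coord (hT : E.IsAdapted SN SG W T) {X : Type u} {S : LCManifold X} {f : X → G}
    {n : X → N} {x : X} (hf : S.SmoothAt SG f x) (hn : S.SmoothAt SN n x) (hx : f x ∈ W) :
    S.SmoothAt T (fun x => E.σ (f x) * E.i (n x)) x :=
  (hT.smoothAt_coord _ _ hx).comp₂ hf hn rfl rfl

/-- Conjugation by an element over `W` is smooth near the unit, by the formula `conj_coord`. -/
theorem smoothAt_conj_of_mem (hT : E.IsAdapted SN SG W T) (hSG : SG.IsLieGroup)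
    (hSN : SN.IsLieGroup) (h1W : 1 ∈ W) (hc : ∀ a ∈ W, ∀ b ∈ W,
      (SG.prod SG).SmoothAt SN (fun y => E.cocycle y.1 y.2) (a, b)) {a : H} (ha : E.p a ∈ W) :
    T.SmoothAt T (fun x => a * x * a⁻¹) 1 := by
  have hp := hT.smooth_p.smoothAt 1
  have hp1 : E.p 1 = 1 := map_one _
  have h1 := hSG.smoothAt_mul (hSG.smoothAt_mul (SmoothAt.const T SG (E.p a) 1) hp)
    (SmoothAt.const T SG (E.p a)⁻¹ 1)
  have h2 := (hc 1 h1W _ ha).comp₂ h1 (SmoothAt.const T SG (E.p a) 1) (by simp) rfl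
  have h3 := (hc _ ha 1 h1W).comp₂ (SmoothAt.const T SG (E.p a) 1) hp rfl hp1
  have h4 := hSN.smoothAt_mul (hSN.smoothAt_mul (hSN.smoothAt_inv h2) h3)
    (hT.smoothAt_κ 1 (by rwa [hp1]))
  refine (hT.smoothAt_of_coord h1 h4 (by simpa using h1W)).congr (Eventually.of_forall fun x => ?_)
  simp only
  rw [← E.conj_coord, E.σ_mul_i]
  -- the central factor of `a` does not matter for conjugation
  nth_rw 1 2 [← E.σ_mul_i a]
  rw [mul_assoc (E.σ (E.p a)), E.central, mul_inv_rev]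
  group

/-- Conjugations are smooth near the unit: this holds for the elements over `W`, which generate
the middle group because `G` is connected. -/
theorem smoothAt_conj (hT : E.IsAdapted SN SG W T) (hSG : SG.IsLieGroup)
    (hSN : SN.IsLieGroup) (hconn : @ConnectedSpace G SG.top) (hW : SG.Open W) (h1W : 1 ∈ W)
    (hc : ∀ a ∈ W, ∀ b ∈ W,
      (SG.prod SG).SmoothAt SN (fun y => E.cocycle y.1 y.2) (a, b)) (a : H) :
    T.SmoothAt T (fun x => a * x * a⁻¹) 1 := by
  let K : Subgroup H :=
    { carrier := {a | T.SmoothAt T (fun x => a * x * a⁻¹) 1 ∧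
        T.SmoothAt T (fun x => a⁻¹ * x * a⁻¹⁻¹) 1}
      one_mem' := by simpa using SmoothAt.id T 1
      mul_mem' := by
        rintro a b ⟨ha, ha'⟩ ⟨hb, hb'⟩
        refine ⟨(ha.comp_of_eq hb (by simp)).congr (Eventually.of_forall fun x => ?_),
          (hb'.comp_of_eq ha' (by simp)).congr (Eventually.of_forall fun x => ?_)⟩ <;>
        group
      inv_mem' := by
        rintro a ⟨ha, ha'⟩
        exact ⟨ha', by simpa only [inv_inv] using ha⟩ }
  have hK : ∀ a, E.p a ∈ W → (E.p a)⁻¹ ∈ W → a ∈ K := fun a ha ha' =>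
    ⟨hT.smoothAt_conj_of_mem hSG hSN h1W hc ha,
      hT.smoothAt_conj_of_mem hSG hSN h1W hc (by rwa [map_inv])⟩
  have htop : K.map E.p = ⊤ := by
    refine hSG.eq_top_of_mem_nhd hconn ?_
    have h1 : ∀ᶠ g in SG.nhd 1, g⁻¹ ∈ W := by
      have := (hSG.2.smoothAt 1).tendsto
      rw [inv_one] at this
      exact this.eventually (hW.mem_nhd h1W)
    filter_upwards [hW.mem_nhd h1W, h1] with g hg hg'
    exact ⟨E.σ g, hK _ (by rwa [E.p_σ]) (by rwa [E.p_σ]), E.p_σ g⟩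
  obtain ⟨b, hb, hab⟩ : E.p a ∈ K.map E.p := htop ▸ Subgroup.mem_top _
  have h2 : b⁻¹ * a ∈ K := hK _ (by simpa [hab] using h1W) (by simpa [hab] using h1W)
  have h3 := K.mul_mem hb h2
  rw [mul_inv_cancel_left] at h3
  exact h3.1

/-- The manifold structure on the middle group is a Lie group structure if the base is connected. -/
theorem isLieGroup (hT : E.IsAdapted SN SG W T) (hSG : SG.IsLieGroup)
    (hSN : SN.IsLieGroup) (hconn : @ConnectedSpace G SG.top) (hW : SG.Open W) (h1W : 1 ∈ W)
    (hc : ∀ a ∈ W, ∀ b ∈ W,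
      (SG.prod SG).SmoothAt SN (fun y => E.cocycle y.1 y.2) (a, b)) : T.IsLieGroup := by
  have hp1 : E.p 1 = 1 := map_one _
  have hp1W : E.p 1 ∈ W := by rwa [hp1]
  refine isLieGroup_of_smoothAt_one (fun a x => (hT.smooth_left a).smoothAt x) ?_ ?_
    (hT.smoothAt_conj hSG hSN hconn hW h1W hc)
  · have hf := SmoothAt.fst T T (1, 1)
    have hs := SmoothAt.snd T T (1, 1)
    have hpf := (hT.smooth_p.smoothAt _).comp hf
    have hps := (hT.smooth_p.smoothAt _).comp hs
    have h1 := (hc 1 h1W 1 h1W).comp₂ hpf hps hp1 hp1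
    have h2 := hSN.smoothAt_mul (hSN.smoothAt_mul h1 ((hT.smoothAt_κ _ hp1W).comp_of_eq hf rfl))
      ((hT.smoothAt_κ _ hp1W).comp_of_eq hs rfl)
    refine (hT.smoothAt_of_coord (hSG.smoothAt_mul hpf hps) h2 (by simpa using h1W)).congr
      (Eventually.of_forall fun y => ?_)
    simp only
    rw [← E.coord_mul, E.σ_mul_i, E.σ_mul_i]
  · have hp := hT.smooth_p.smoothAt 1
    have hpi := hSG.smoothAt_inv hp
    have h1 := (hc 1 h1W 1 h1W).comp₂ hp hpi hp1 (by simp)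
    have h2 := hSN.smoothAt_inv (hSN.smoothAt_mul h1 (hT.smoothAt_κ _ hp1W))
    refine (hT.smoothAt_of_coord hpi h2 (by simpa using h1W)).congr
      (Eventually.of_forall fun x => ?_)
    simp only
    rw [← E.coord_inv, E.σ_mul_i]

/-- The translated coordinates are local trivialisations of the projection. -/
theorem isSmoothPrincipalBundle (hT : E.IsAdapted SN SG W T) (hSG : SG.IsLieGroup)
    (hW : SG.Open W) (h1W : 1 ∈ W) : IsSmoothPrincipalBundle SN T SG E.i E.p where
  smooth_incl := smooth_of_smoothAt fun n =>
    (hT.smoothAt_of_coord (SmoothAt.const SN SG 1 n) (SmoothAt.id SN n) h1W).congr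
      (Eventually.of_forall fun m => by simp [E.σ_one])
  smooth_proj := hT.smooth_p
  free := E.injective
  fibre x y := by
    constructor
    · intro h
      refine ⟨(E.κ x)⁻¹ * E.κ y, ?_⟩
      have h1 := E.σ_mul_i x
      nth_rw 1 [← E.σ_mul_i y]
      rw [← h, map_mul, ← mul_assoc, map_inv]
      nth_rw 2 [← h1]
      simp
    · rintro ⟨n, rfl⟩
      simp [E.p_i]
  locally_trivial b := by
    have hmul : ∀ x, SG.SmoothAt SG (fun w => b⁻¹ * w) x := fun x =>
      hSG.smoothAt_mul (SmoothAt.const SG SG b⁻¹ x) (SmoothAt.id SG x)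
    have hV : SG.Open (univ ∩ (fun w => b⁻¹ * w) ⁻¹' W) :=
      (smoothOn_of_smoothAt fun x _ => hmul x).open_inter_preimage SG.open_univ hW
    rw [univ_inter] at hV
    have hb : E.p (E.σ b)⁻¹ = b⁻¹ := by rw [map_inv, E.p_σ]
    refine ⟨_, hV, by simpa using h1W, fun w => E.σ b * E.σ (b⁻¹ * w),
      fun x => E.κ ((E.σ b)⁻¹ * x), smoothOn_of_smoothAt fun w hw => ?_, fun w _ => ?_,
      smoothOn_of_smoothAt fun x hx => ?_, fun x _ => ?_⟩
    · have h1 := hT.smoothAt_of_coord (hmul w) (SmoothAt.const SG SN 1 w) hw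
      simpa using ((hT.smooth_left (E.σ b)).smoothAt _).comp h1
    · simp [E.p_σ]
    · exact (hT.smoothAt_κ _ (by rw [map_mul, hb]; exact hx)).comp
        ((hT.smooth_left _).smoothAt x)
    · have := E.σ_mul_i ((E.σ b)⁻¹ * x)
      rw [map_mul, hb] at this
      rw [mul_assoc, this, mul_inv_cancel_left]

end IsAdapted

end SectionedExtension

/-! ### Natural Lie group structures on isomorphism classes -/

section Natural

open LCManifold

variable {𝒢 : TwoGroup.{u}} {S₀ : LCManifold 𝒢.Obj} {T T' : LCManifold 𝒢.Skel}

theorem IsNaturalLieStructure.of_smoothAt (hT : T.IsLieGroup)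
    (hcls : S₀.SmoothAt T 𝒢.cls 𝒢.unit) {σ : 𝒢.Skel → 𝒢.Obj} (hσ : T.SmoothAt S₀ σ 1)
    (hσ1 : σ 1 = 𝒢.unit) (hsec : ∀ᶠ v in T.nhd 1, 𝒢.cls (σ v) = v) :
    IsNaturalLieStructure 𝒢 S₀ T := by
  refine ⟨hT, hcls, ?_⟩
  obtain ⟨V, hV, h1V, hσV⟩ := hσ
  obtain ⟨V', hV', hV'o, h1V'⟩ := mem_nhd.1 hsec
  exact ⟨V ∩ V', σ, hV.inter hV'o, ⟨h1V, h1V'⟩, hσV.mono inter_subset_left, hσ1,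
    fun v hv => hV' hv.2⟩

/-- Two natural Lie group structures agree: near the unit, the identity is the composite of a
section for the first structure and the projection for the second one. -/
theorem IsNaturalLieStructure.smooth_id (hT : IsNaturalLieStructure 𝒢 S₀ T)
    (hT' : IsNaturalLieStructure 𝒢 S₀ T') : T.Smooth T' id := by
  obtain ⟨hL, -, V, σ, hV, h1V, hσ, hσ1, hsec⟩ := hT
  obtain ⟨hL', hcls, -⟩ := hT'
  refine hL.smooth_of_smoothAt_one hL' (MonoidHom.id _) ?_
  refine (SmoothAt.comp_of_eq (S := T) (T := S₀) (R := T') (y := 𝒢.unit) hcls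
    (hσ.smoothAt hV h1V) hσ1).congr ?_
  filter_upwards [hV.mem_nhd h1V] with v hv
  exact (hsec v hv).symm

end Natural

/-! ### The isomorphism classes of the strict abelian 2-group -/

section Abelian

open LCManifold

variable {A Z : Type u} [CommGroup A] [CommGroup Z] (τ : A →* Z)

/-- The projection of `Z` onto the isomorphism classes of `𝒵_τ`, as a homomorphism. -/
def TwoGroup.clsHom : Z →* (TwoGroup.ofAbelian τ).Skel :=
  MonoidHom.mk' (TwoGroup.ofAbelian τ).cls fun _ _ => rfl

theorem TwoGroup.clsHom_surjective : Function.Surjective (TwoGroup.clsHom τ) := by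
  rintro ⟨z⟩
  exact ⟨z, rfl⟩

theorem TwoGroup.clsHom_eq_iff {z z' : Z} :
    TwoGroup.clsHom τ z = TwoGroup.clsHom τ z' ↔ ∃ a, z' = τ a * z := by
  constructor
  · intro h
    obtain ⟨f, hf, hf', -⟩ := Quotient.exact h
    refine ⟨f.1, ?_⟩
    rw [← hf', ← hf]
    rfl
  · rintro ⟨a, rfl⟩
    refine Quotient.sound ⟨(a, z), rfl, rfl, (a⁻¹, τ a * z), rfl, ?_, ?_, ?_⟩ <;>
      simp [TwoGroup.ofAbelian]

theorem TwoGroup.ker_clsHom : (TwoGroup.clsHom τ).ker = τ.range := by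
  ext z
  rw [MonoidHom.mem_ker, ← map_one (TwoGroup.clsHom τ), eq_comm, TwoGroup.clsHom_eq_iff]
  simp [MonoidHom.mem_range, eq_comm]

/-- The isomorphism classes of `𝒵_τ` form the quotient of `Z` by the image of `τ`. -/
noncomputable def TwoGroup.skelAbelianEquiv : (TwoGroup.ofAbelian τ).Skel ≃* Z ⧸ τ.range :=
  ((QuotientGroup.quotientMulEquivOfEq (TwoGroup.ker_clsHom τ).symm).trans
    (QuotientGroup.quotientKerEquivOfSurjective _ (TwoGroup.clsHom_surjective τ))).symm

theorem TwoGroup.skelAbelianEquiv_cls (z : Z) :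
    TwoGroup.skelAbelianEquiv τ ((TwoGroup.ofAbelian τ).cls z) = (z : Z ⧸ τ.range) := by
  rw [TwoGroup.skelAbelianEquiv, MulEquiv.symm_apply_eq]
  rfl

variable {τ} {SZ : LCManifold Z}

/-- The Lie group structure on the isomorphism classes of `𝒵_τ`, transported from `Z ⧸ τ(A)`. -/
theorem exists_natural_skel_ofAbelian (hZ : SZ.IsLieGroup) (hsplit : SplitLieSubgroup SZ τ.range) :
    ∃ TZ : LCManifold (TwoGroup.ofAbelian τ).Skel,
      IsNaturalLieStructure (TwoGroup.ofAbelian τ) SZ TZ ∧ SZ.Smooth TZ (TwoGroup.clsHom τ) ∧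
      TZ.Smooth hsplit.quot (TwoGroup.skelAbelianEquiv τ) ∧
      hsplit.quot.Smooth TZ (TwoGroup.skelAbelianEquiv τ).symm := by
  obtain ⟨TZ, h1, h2⟩ := exists_transported hsplit.quot (TwoGroup.skelAbelianEquiv τ).toEquiv
  have hcls : SZ.Smooth TZ (TwoGroup.clsHom τ) := smooth_of_smoothAt fun z =>
    ((h2.smoothAt _).comp (hsplit.bundle.smooth_proj.smoothAt z)).congr
      (Eventually.of_forall fun z =>
        ((MulEquiv.symm_apply_eq _).2 (TwoGroup.skelAbelianEquiv_cls τ z).symm).symm)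
  have hsec : ∀ b, ∃ σ : (TwoGroup.ofAbelian τ).Skel → Z, TZ.SmoothAt SZ σ b ∧
      ∀ᶠ w in TZ.nhd b, TwoGroup.clsHom τ (σ w) = w := by
    intro b
    obtain ⟨W, hW, hbW, σ, κ, hσ, hσW, -⟩ :=
      hsplit.bundle.locally_trivial (TwoGroup.skelAbelianEquiv τ b)
    refine ⟨fun w => σ (TwoGroup.skelAbelianEquiv τ w),
      (hσ.smoothAt hW hbW).comp (h1.smoothAt b), ?_⟩
    filter_upwards [(h1.smoothAt b).tendsto.eventually (hW.mem_nhd hbW)] with w hw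
    apply (TwoGroup.skelAbelianEquiv τ).injective
    exact (TwoGroup.skelAbelianEquiv_cls τ _).trans (hσW _ hw)
  have hLie : TZ.IsLieGroup := hZ.of_sections _ hcls hsec
  obtain ⟨σ, hσ, hσ'⟩ := hsec 1
  refine ⟨TZ, ?_, hcls, h1, h2⟩
  -- a section is translated so that it preserves the unit
  let ρ : (TwoGroup.ofAbelian τ).Skel → Z := fun w => σ w * (σ 1)⁻¹
  refine IsNaturalLieStructure.of_smoothAt (σ := ρ) hLie (hcls.smoothAt 1)
    (hZ.smoothAt_mul hσ (SmoothAt.const _ _ _ _)) (mul_inv_cancel (σ 1)) ?_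
  have h3 : TwoGroup.clsHom τ (σ 1) = 1 :=
    self_of_eventually (p := fun w => TwoGroup.clsHom τ (σ w) = w) hσ'
  filter_upwards [hσ'] with w hw
  have : TwoGroup.clsHom τ (σ w * (σ 1)⁻¹) = w := by
    rw [map_mul, map_inv, hw, h3, inv_one, mul_one]
  exact this

end Abelian

/-! ### The band of a generalised central extension -/

namespace IsGenCentralExtension

variable {A Z G : Type u} [CommGroup A] [CommGroup Z] [Group G]
    {τ : A →* Z} {𝒢 : TwoGroup.{u}} {ι : TwoGroup.Hom (TwoGroup.ofAbelian τ) 𝒢}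
    {q : TwoGroup.Hom 𝒢 (TwoGroup.ofGroup G)}

variable (q) in
/-- The projection `skel q` with values in `G`. -/
def skelProj : 𝒢.Skel →* G := (TwoGroup.skelOfGroup G).toMonoidHom.comp q.skel

theorem skelProj_cls (x : 𝒢.Obj) : skelProj q (𝒢.cls x) = q.obj x := rfl

theorem q_mor (f : 𝒢.Mor) : q.mor f = q.obj (𝒢.src f) := q.src_mor f

theorem obj_injective (h : IsGenCentralExtension ι q) : Function.Injective ι.obj := by
  intro z z' hz
  have h1 : ι.mor ((1 : A), z) = ι.mor ((1 : A), z') :=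
    (ι.mor_ident z).trans ((congrArg 𝒢.ident hz).trans (ι.mor_ident z').symm)
  exact congrArg Prod.snd (h.injective h1)

theorem exact_obj (h : IsGenCentralExtension ι q) (x : 𝒢.Obj) :
    q.obj x = (1 : G) ↔ ∃ z : Z, ι.obj z = x := by
  constructor
  · intro hx
    have h1 : q.mor (𝒢.ident x) = (1 : G) := by
      rw [q_mor, 𝒢.src_ident]
      exact hx
    obtain ⟨f, hf⟩ := (h.exact _).2 h1
    refine ⟨(TwoGroup.ofAbelian τ).src f, ?_⟩
    rw [← ι.src_mor, hf, 𝒢.src_ident]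
  · rintro ⟨z, rfl⟩
    have h1 := (h.exact _).1 (mem_range_self ((TwoGroup.ofAbelian τ).ident z))
    rw [q_mor, ι.src_mor] at h1
    exact h1

theorem central_obj (h : IsGenCentralExtension ι q) (z : Z) (x : 𝒢.Obj) :
    𝒢.tensObj (ι.obj z) x = 𝒢.tensObj x (ι.obj z) := by
  have h1 := congrArg 𝒢.src (h.central ((TwoGroup.ofAbelian τ).ident z) (𝒢.ident x))
  rw [𝒢.src_tens, 𝒢.src_tens, ι.src_mor, 𝒢.src_ident] at h1
  exact h1

theorem skel_injective (h : IsGenCentralExtension ι q) : Function.Injective ι.skel := by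
  rintro ⟨z⟩ ⟨z'⟩ hz
  obtain ⟨f, hf, hf', -⟩ := Quotient.exact hz
  have h1 : q.mor f = (1 : G) := by
    rw [q_mor, hf]
    exact (h.exact_obj _).2 ⟨z, rfl⟩
  obtain ⟨⟨a, z₀⟩, rfl⟩ := (h.exact _).2 h1
  obtain rfl : z₀ = z := h.obj_injective ((ι.src_mor _).symm.trans hf)
  have h2 : τ a * z₀ = z' := h.obj_injective ((ι.tgt_mor _).symm.trans hf')
  exact (TwoGroup.clsHom_eq_iff τ).2 ⟨a, h2.symm⟩

theorem skel_central (h : IsGenCentralExtension ι q) (n : (TwoGroup.ofAbelian τ).Skel)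
    (x : 𝒢.Skel) : ι.skel n * x = x * ι.skel n := by
  obtain ⟨z⟩ := n
  obtain ⟨x⟩ := x
  exact congrArg 𝒢.cls (h.central_obj z x)

theorem skelProj_skel (h : IsGenCentralExtension ι q) (n : (TwoGroup.ofAbelian τ).Skel) :
    skelProj q (ι.skel n) = 1 := by
  obtain ⟨z⟩ := n
  exact (h.exact_obj _).2 ⟨z, rfl⟩

theorem exists_skel_eq (h : IsGenCentralExtension ι q) {x : 𝒢.Skel} (hx : skelProj q x = 1) :
    ∃ n, ι.skel n = x := by
  obtain ⟨x⟩ := x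
  obtain ⟨z, hz⟩ := (h.exact_obj x).1 hx
  exact ⟨(TwoGroup.ofAbelian τ).cls z, congrArg 𝒢.cls hz⟩

/-- The extension of isomorphism classes, with the section induced by a section `s` of `q` on
objects. -/
noncomputable def sectioned (h : IsGenCentralExtension ι q) (s : G → 𝒢.Obj) (hs1 : s 1 = 𝒢.unit)
    (hs : ∀ g, q.obj (s g) = g) : SectionedExtension (TwoGroup.ofAbelian τ).Skel 𝒢.Skel G :=
  have hex : ∀ x, ∃ n, ι.skel n = (𝒢.cls (s (skelProj q x)))⁻¹ * x := fun x =>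
    h.exists_skel_eq (by
      rw [map_mul, map_inv, skelProj_cls]
      exact inv_mul_eq_one.2 (hs _))
  { i := ι.skel
    p := skelProj q
    σ := fun g => 𝒢.cls (s g)
    κ := fun x => (hex x).choose
    injective := h.skel_injective
    central := h.skel_central
    p_i := h.skelProj_skel
    p_σ := hs
    σ_one := congrArg 𝒢.cls hs1
    σ_mul_i := fun x => by rw [(hex x).choose_spec, mul_inv_cancel_left] }

/-- The fibre coordinate of the class of `x` is the class of the element `z` of `Z` with
`ι z = x ⊗ bar (s (q x))`. -/
theorem sectioned_κ_cls (h : IsGenCentralExtension ι q) {s : G → 𝒢.Obj} (hs1 : s 1 = 𝒢.unit)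
    (hs : ∀ g, q.obj (s g) = g) {x : 𝒢.Obj} {z : Z}
    (hz : ι.obj z = 𝒢.tensObj x (𝒢.barObj (s (q.obj x)))) :
    (h.sectioned s hs1 hs).κ (𝒢.cls x) = TwoGroup.clsHom τ z := by
  apply h.skel_injective
  have h1 : (h.sectioned s hs1 hs).σ (q.obj x) * ι.skel ((h.sectioned s hs1 hs).κ (𝒢.cls x)) =
    𝒢.cls x := (h.sectioned s hs1 hs).σ_mul_i (𝒢.cls x)
  have h2 : ι.skel (TwoGroup.clsHom τ z) =
      𝒢.cls x * ((h.sectioned s hs1 hs).σ (q.obj x))⁻¹ := congrArg 𝒢.cls hz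
  rw [h2, eq_mul_inv_iff_mul_eq, h.skel_central]
  exact h1

end IsGenCentralExtension

namespace IsSmoothGenCentralExtension

open LCManifold IsGenCentralExtension

variable {A Z G : Type u} [CommGroup A] [CommGroup Z] [Group G]
    {τ : A →* Z} {𝒢 : TwoGroup.{u}} {ι : TwoGroup.Hom (TwoGroup.ofAbelian τ) 𝒢}
    {q : TwoGroup.Hom 𝒢 (TwoGroup.ofGroup G)} {SA : LCManifold A} {SZ : LCManifold Z}
    {SG : LCManifold G} {S₀ : LCManifold 𝒢.Obj} {S₁ : LCManifold 𝒢.Mor}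

theorem smoothAt_tensObj (h : IsSmoothGenCentralExtension SA SZ SG S₀ S₁ ι q) :
    (S₀.prod S₀).SmoothAt S₀ (fun p => 𝒢.tensObj p.1 p.2) (𝒢.unit, 𝒢.unit) := by
  obtain ⟨U₀, U₁, hU, h1, ht, -⟩ := h.lie_mid.locally_smooth
  exact ht.smoothAt (hU.open_obj.prod hU.open_obj) ⟨h1, h1⟩

theorem smoothAt_barObj (h : IsSmoothGenCentralExtension SA SZ SG S₀ S₁ ι q) :
    S₀.SmoothAt S₀ 𝒢.barObj 𝒢.unit := by
  obtain ⟨U₀, U₁, hU, h1, -, -, hb, -⟩ := h.lie_mid.locally_smooth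
  exact hb.smoothAt hU.open_obj h1

theorem smoothAt_ι (h : IsSmoothGenCentralExtension SA SZ SG S₀ S₁ ι q) :
    SZ.SmoothAt S₀ ι.obj (1 : Z) := by
  obtain ⟨U₀, U₁, hU, h1, hι, -⟩ := h.lie_incl
  exact SmoothOn.smoothAt (M := Z) hι hU.open_obj h1

theorem smoothAt_q (h : IsSmoothGenCentralExtension SA SZ SG S₀ S₁ ι q) :
    S₀.SmoothAt SG q.obj 𝒢.unit := by
  obtain ⟨U₀, U₁, hU, h1, hq, -⟩ := h.lie_proj
  exact SmoothOn.smoothAt (N := G) hq hU.open_obj h1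

theorem barObj_unit (𝒢 : TwoGroup.{u}) : 𝒢.barObj 𝒢.unit = 𝒢.unit := by
  rw [← 𝒢.unit_tensObj (𝒢.barObj 𝒢.unit), 𝒢.tensObj_bar]

/-- A set-theoretic section of `q` on all of `G` that is smooth near the unit. -/
theorem exists_section (h : IsSmoothGenCentralExtension SA SZ SG S₀ S₁ ι q) :
    ∃ s : G → 𝒢.Obj, SG.SmoothAt S₀ s 1 ∧ s 1 = 𝒢.unit ∧ ∀ g, q.obj (s g) = g := by
  classical
  obtain ⟨U, s, hU, h1U, hs1, hs, hqs⟩ := h.sect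
  have hsurj : ∀ g : G, ∃ x, q.obj x = g := fun g => by
    obtain ⟨f, hf⟩ := h.surjective g
    exact ⟨𝒢.src f, (q_mor f).symm.trans hf⟩
  choose t ht using hsurj
  refine ⟨fun g => if g ∈ U then s g else t g, (hs.smoothAt hU h1U).congr ?_, ?_, fun g => ?_⟩
  · filter_upwards [hU.mem_nhd h1U] with g hg
    rw [if_pos hg]
  · simp only [if_pos h1U, hs1]
  · by_cases hg : g ∈ U
    · simp only [if_pos hg]
      exact hqs g hg
    · simp only [if_neg hg]
      exact ht g

variable {TZ : LCManifold (TwoGroup.ofAbelian τ).Skel}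

/-- The fibre coordinate is smooth as a function on the manifold of objects, because the inverse of
`ι` is smooth near the unit. -/
theorem smoothAt_κ_cls (h : IsSmoothGenCentralExtension SA SZ SG S₀ S₁ ι q)
    (hcls : SZ.Smooth TZ (TwoGroup.clsHom τ)) {s : G → 𝒢.Obj} (hs : SG.SmoothAt S₀ s 1)
    (hs1 : s 1 = 𝒢.unit) (hqs : ∀ g, q.obj (s g) = g) :
    S₀.SmoothAt TZ (fun x => (h.sectioned s hs1 hqs).κ (𝒢.cls x)) 𝒢.unit := by
  obtain ⟨N, r, hN, h1N, hr, hrι⟩ := h.embedding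
  have hq1 : q.obj 𝒢.unit = (1 : G) := q.obj_unit
  have h1 : S₀.SmoothAt S₀ (fun x => s (q.obj x)) 𝒢.unit := hs.comp_of_eq h.smoothAt_q hq1
  have h2 := h.smoothAt_barObj.comp_of_eq h1 (by rw [hq1, hs1])
  have h3 := h.smoothAt_tensObj.comp₂ (SmoothAt.id S₀ 𝒢.unit) h2 rfl
    (by rw [hq1, hs1, barObj_unit])
  have h4 : 𝒢.tensObj 𝒢.unit (𝒢.barObj (s (q.obj 𝒢.unit))) = 𝒢.unit := by
    rw [hq1, hs1, 𝒢.tensObj_bar]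
  refine ((hcls.smoothAt _).comp ((hr.smoothAt hN h1N).comp_of_eq h3 h4)).congr ?_
  filter_upwards [h3.tendsto.eventually (hN.mem_nhd (by rw [h4]; exact h1N))] with x hx
  have h5 : skelProj q (𝒢.cls x * (𝒢.cls (s (q.obj x)))⁻¹) = 1 := by
    rw [map_mul, map_inv, mul_inv_eq_one]
    exact (hqs _).symm
  obtain ⟨z, hz⟩ := (h.exact_obj (𝒢.tensObj x (𝒢.barObj (s (q.obj x))))).1 h5
  rw [h.sectioned_κ_cls hs1 hqs hz, ← hz, hrι z (by rw [hz]; exact hx)]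

theorem smoothAt_cocycle (h : IsSmoothGenCentralExtension SA SZ SG S₀ S₁ ι q)
    (hcls : SZ.Smooth TZ (TwoGroup.clsHom τ)) {s : G → 𝒢.Obj} (hs : SG.SmoothAt S₀ s 1)
    (hs1 : s 1 = 𝒢.unit) (hqs : ∀ g, q.obj (s g) = g) :
    (SG.prod SG).SmoothAt TZ (fun y => (h.sectioned s hs1 hqs).cocycle y.1 y.2) (1, 1) := by
  have h1 := h.smoothAt_tensObj.comp₂ (hs.comp_of_eq (SmoothAt.fst SG SG (1, 1)) rfl)
    (hs.comp_of_eq (SmoothAt.snd SG SG (1, 1)) rfl) hs1 hs1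
  exact (h.smoothAt_κ_cls hcls hs hs1 hqs).comp_of_eq h1 (by rw [hs1, 𝒢.tensObj_unit])

/-- A Lie group structure that is adapted to a section of `q` is natural. -/
theorem isNatural_of_isAdapted (h : IsSmoothGenCentralExtension SA SZ SG S₀ S₁ ι q)
    (hTZ : IsNaturalLieStructure (TwoGroup.ofAbelian τ) SZ TZ)
    (hcls : SZ.Smooth TZ (TwoGroup.clsHom τ)) {s : G → 𝒢.Obj} (hs : SG.SmoothAt S₀ s 1)
    (hs1 : s 1 = 𝒢.unit) (hqs : ∀ g, q.obj (s g) = g) {W : Set G} (h1W : 1 ∈ W)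
    {T : LCManifold 𝒢.Skel} (hT : (h.sectioned s hs1 hqs).IsAdapted TZ SG W T)
    (hL : T.IsLieGroup) : IsNaturalLieStructure 𝒢 S₀ T := by
  set E := h.sectioned s hs1 hqs with hE
  obtain ⟨-, -, V, ζ, hV, h1V, hζ, hζ1, hζV⟩ := hTZ
  have hp1 : E.p 1 = 1 := map_one _
  have hκ1 : E.κ 1 = 1 := by rw [← map_one E.i, E.κ_i]
  have hp := hT.smooth_p.smoothAt 1
  have hκ := hT.smoothAt_κ 1 (by rwa [hp1])
  have h1 := hs.comp_of_eq hp hp1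
  have h2 : T.SmoothAt SZ (fun x => ζ (E.κ x)) 1 := (hζ.smoothAt hV h1V).comp_of_eq hκ hκ1
  have hζ1' : ζ (E.κ 1) = (1 : Z) := by rw [hκ1]; exact hζ1
  have h3 := h.smoothAt_ι.comp_of_eq h2 hζ1'
  have hsu : s (E.p 1) = 𝒢.unit := by rw [hp1, hs1]
  have hιu : ι.obj (ζ (E.κ 1)) = 𝒢.unit := by
    rw [hζ1']
    exact ι.obj_unit
  refine IsNaturalLieStructure.of_smoothAt
    (σ := fun x => 𝒢.tensObj (s (E.p x)) (ι.obj (ζ (E.κ x)))) hL ?_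
    (h.smoothAt_tensObj.comp₂ h1 h3 hsu hιu) ?_ ?_
  · refine (hT.smoothAt_of_coord h.smoothAt_q (h.smoothAt_κ_cls hcls hs hs1 hqs) ?_).congr
      (Eventually.of_forall fun x => (E.σ_mul_i (𝒢.cls x)).symm)
    rw [q.obj_unit]
    exact h1W
  · rw [hsu, hιu, 𝒢.tensObj_unit]
  · filter_upwards [hκ.tendsto.eventually (hV.mem_nhd (by rwa [hκ1]))] with x hx
    have h5 : 𝒢.cls (𝒢.tensObj (s (E.p x)) (ι.obj (ζ (E.κ x)))) =
      E.σ (E.p x) * E.i ((TwoGroup.ofAbelian τ).cls (ζ (E.κ x))) := rfl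
    rw [h5, hζV _ hx, E.σ_mul_i]

end IsSmoothGenCentralExtension

theorem mainTheorem6 {A Z G : Type u} [CommGroup A] [CommGroup Z] [Group G] (τ : A →* Z)
    (𝒢 : TwoGroup.{u}) (SA : LCManifold A) (SZ : LCManifold Z) (SG : LCManifold G)
    (S₀ : LCManifold 𝒢.Obj) (S₁ : LCManifold 𝒢.Mor)
    (ι : TwoGroup.Hom (TwoGroup.ofAbelian τ) 𝒢) (q : TwoGroup.Hom 𝒢 (TwoGroup.ofGroup G))
    (hext : IsSmoothGenCentralExtension SA SZ SG S₀ S₁ ι q)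
    (hconn : @ConnectedSpace G SG.top)
    (hsplit : SplitLieSubgroup SZ τ.range) :
    ∃ (TZ : LCManifold (TwoGroup.ofAbelian τ).Skel) (TG : LCManifold 𝒢.Skel),
      -- natural Lie group structures, which are unique as such
      IsNaturalLieStructure (TwoGroup.ofAbelian τ) SZ TZ ∧
      IsNaturalLieStructure 𝒢 S₀ TG ∧
      (∀ TZ' : LCManifold (TwoGroup.ofAbelian τ).Skel,
        IsNaturalLieStructure (TwoGroup.ofAbelian τ) SZ TZ' →
          TZ.Smooth TZ' id ∧ TZ'.Smooth TZ id) ∧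
      (∀ TG' : LCManifold 𝒢.Skel, IsNaturalLieStructure 𝒢 S₀ TG' →
          TG.Smooth TG' id ∧ TG'.Smooth TG id) ∧
      -- the group of isomorphism classes of `𝒵` is the Lie group `Z ⧸ τ(A)`
      (∃ φ : (TwoGroup.ofAbelian τ).Skel ≃* Z ⧸ τ.range,
        (∀ z : Z, φ ((TwoGroup.ofAbelian τ).cls z) = (z : Z ⧸ τ.range)) ∧
        TZ.Smooth hsplit.quot φ ∧ hsplit.quot.Smooth TZ φ.symm) ∧
      -- the central extension of Lie groups
      IsCentralExtension TZ TG SG ι.skel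
        ((TwoGroup.skelOfGroup G).toMonoidHom.comp q.skel) := by
  obtain ⟨TZ, hTZ, hcls, hφ, hφ'⟩ := exists_natural_skel_ofAbelian hext.lie_Z hsplit
  obtain ⟨s, hs, hs1, hqs⟩ := hext.exists_section
  obtain ⟨W, hW, h1W, hc⟩ := (hext.sectioned s hs1 hqs).exists_open_smoothAt_cocycle
    (hext.smoothAt_cocycle hcls hs hs1 hqs)
  obtain ⟨TG, hTG⟩ := (hext.sectioned s hs1 hqs).exists_isAdapted hext.lie_G hTZ.1 hW h1W hc
  have hL := hTG.isLieGroup hext.lie_G hTZ.1 hconn hW h1W hc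
  have hnat := hext.isNatural_of_isAdapted hTZ hcls hs hs1 hqs h1W hTG hL
  refine ⟨TZ, TG, hTZ, hnat, fun _ h => ⟨hTZ.smooth_id h, h.smooth_id hTZ⟩,
    fun _ h => ⟨hnat.smooth_id h, h.smooth_id hnat⟩,
    ⟨TwoGroup.skelAbelianEquiv τ, TwoGroup.skelAbelianEquiv_cls τ, hφ, hφ'⟩, ?_⟩
  exact
    { lie_left := hTZ.1
      lie_mid := hL
      lie_right := hext.lie_G
      injective := hext.skel_injective
      exact := by
        ext x
        constructor
        · rintro ⟨n, rfl⟩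
          exact hext.skelProj_skel n
        · exact fun hx => hext.exists_skel_eq hx
      surjective := fun g => ⟨𝒢.cls (s g), hqs g⟩
      central := hext.skel_central
      bundle := hTG.isSmoothPrincipalBundle hext.lie_G hW h1W }
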